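/- Let $r(0),r(1),r(2),\dots$ be integers with $r(0)=1$ and $r(m)\le r(m+1)\le r(m)+1$ for all $m\ge0$, and let $X_1,X_2,\dots$ be i.i.d. $\mathrm{Exp}(1)$ random variables (the values of the candidates). Candidates $1,2,\dots$ are examined in order; if $m\ge 0$ candidates have been accepted so far, the next candidate is accepted if and only if her value exceeds the threshold $Y_m$, defined as the $r(m)$-th largest of the $m$ values already accepted, with $Y_m:=0$ if $r(m)=m+1$. Let $N_m$ be the index of the $m$-th accepted candidate, let $y_m:=\mathbb E\,Y_m$, and let $\hat\sigma_m^2:=\sum_{k=1}^m r(k)^{-2}$, $\hat\sigma_m\ge0$. Suppose that $\sum_{m} r(m)^{-2}=\infty$. Then almost surely infinitely many candidates are accepted (so that every $N_m$ and $Y_m$ is well defined), every $Y_m$ is integrable, and, as $m\to\infty$, $$\frac{\log N_m-\bigl(y_m+\log r(m)\bigr)}{\hat\sigma_m}\ \xrightarrow{d}\ N(0,1).$$ In other words, $N_m$ is asymptotically log-normal. -/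

import Mathlib

open MeasureTheory ProbabilityTheory Filter

noncomputable section

namespace Hiring

/-- The threshold when the candidates with indices in `S` have been accepted: writing `m = #S`, it is
the `r m`-th largest of the values `x i`, `i ∈ S`, and it is `0` if there are fewer than `r m` such
values, that is, if `r m = m + 1`. -/
def thresholdOf (r : ℕ → ℕ) (x : ℕ → ℝ) (S : Finset ℕ) : ℝ :=
  ((S.val.map x).sort (· ≥ ·)).getD (r S.card - 1) 0

/-- The set of indices of the candidates accepted among `1, …, n`, when candidate `i ≥ 1` has value
`x i`: a candidate is accepted if and only if her value exceeds the current threshold. -/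
def accepted (r : ℕ → ℕ) (x : ℕ → ℝ) : ℕ → Finset ℕ
  | 0 => ∅
  | n + 1 =>
    if thresholdOf r x (accepted r x n) < x (n + 1) then insert (n + 1) (accepted r x n)
    else accepted r x n

/-- `M_n`, the number of candidates accepted among `1, …, n`. -/
def numAccepted (r : ℕ → ℕ) (x : ℕ → ℝ) (n : ℕ) : ℕ :=
  (accepted r x n).card

/-- `N_m`, the index of the `m`-th accepted candidate, i.e. the smallest `n` with `M_n ≥ m`
(and `N_0 = 0`). -/
def acceptIndex (r : ℕ → ℕ) (x : ℕ → ℝ) (m : ℕ) : ℕ :=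
  sInf {n : ℕ | m ≤ numAccepted r x n}

/-- `Y_m`, the threshold after `m` candidates have been accepted. -/
def threshold (r : ℕ → ℕ) (x : ℕ → ℝ) (m : ℕ) : ℝ :=
  thresholdOf r x (accepted r x (acceptIndex r x m))

/-- `σ̂_m = (∑_{k=1}^m r(k)⁻²)^{1/2}`. -/
def sigmaHat (r : ℕ → ℕ) (m : ℕ) : ℝ :=
  Real.sqrt (∑ k ∈ Finset.Icc 1 m, 1 / (r k : ℝ) ^ 2)

end Hiring

end

/-! The threshold never decreases, so every examined candidate whose value exceeds the current
threshold has been accepted. Almost surely exactly `r m - 1` of the examined values lie strictly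
above `Y_m`. If the rank increases at the next acceptance, the threshold stays. If the rank does not
change, the new threshold is the minimum of the `r m` values above `Y_m`, the newcomer included. By
memorylessness their excesses over `Y_m` are independent Exp(1), so the increment is Exp(`r m`) and
independent of `Y_m` (`map_threshold_succ_of_rank_eq`). Hence `Y_m` is distributed as a sum of
independent Exp(`r k`) variables over those `k < m` with `r (k + 1) = r k`; its mean and variance
are `staySum`s of `1 / a` and `1 / a ^ 2`.

The variance differs from `sigmaHat r m ^ 2` by at most 2, because the omitted ranks are distinct.
As `sigmaHat` tends to infinity and all rates are at least 1, a second-order expansion of the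
logarithm of the characteristic function gives asymptotic normality of `Y_m`
(`tendstoInDistribution_threshold`).

It remains to compare `log N_m` with `Y_m + log r(m)`. About `n * exp (-s)` of the first `n` values
exceed `s`, and about `r m` of the first `N_m` values exceed `Y_m`, so `N_m` is close to `r m * exp
Y_m`. Since `N_m` and `Y_m` are dependent, `Y_m` is first localised to unit intervals with
deterministic endpoints. Markov and Chebyshev bounds on each interval, followed by a union bound,
show that the error is negligible against `sigmaHat` (`tendstoInMeasure_logIndexError`). Slutsky's
theorem concludes. -/

namespace Hiring

/-! ### Thresholds as order statistics -/

/-- In a list sorted in decreasing order, the entry at position `k` is at most `s` if and only if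
at most `k` entries exceed `s`. -/
theorem getD_le_iff_countP_le {L : List ℝ} (hL : L.Pairwise (· ≥ ·)) {d s : ℝ} (k : ℕ)
    (h : k < L.length ∨ d ≤ s) :
    L.getD k d ≤ s ↔ L.countP (fun a => decide (s < a)) ≤ k := by
  induction L generalizing k with
  | nil => simpa using h
  | cons a l ih =>
    rw [List.pairwise_cons] at hL
    have hzero : a ≤ s → l.countP (fun a => decide (s < a)) = 0 := by
      intro has
      rw [List.countP_eq_zero]
      intro b hb
      simpa using (hL.1 b hb).trans has
    cases k with
    | zero =>
      by_cases has : a ≤ s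
      · simp [has, hzero has, not_lt.mpr has]
      · simp [has, not_le.mp has]
    | succ k =>
      have h' : k < l.length ∨ d ≤ s := h.imp (by simp) id
      have := ih hL.2 k h'
      rw [List.getD_cons_succ, this, List.countP_cons]
      by_cases has : a ≤ s
      · simp [hzero has, not_lt.mpr has]
      · simp [not_le.mp has]

/-- All later order arguments go through this criterion. The second hypothesis handles the default
value: when the rank exceeds the number of accepted values, the threshold is 0 and the equivalence
can fail for negative `s`. -/
theorem thresholdOf_le_iff {r : ℕ → ℕ} {x : ℕ → ℝ} {S : Finset ℕ} {s : ℝ} (hr : 1 ≤ r S.card)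
    (h : r S.card ≤ S.card ∨ 0 ≤ s) :
    thresholdOf r x S ≤ s ↔ (S.filter (fun i => s < x i)).card < r S.card := by
  unfold thresholdOf
  rw [getD_le_iff_countP_le (Multiset.pairwise_sort _ _)]
  · rw [← Multiset.coe_countP, Multiset.sort_eq, Multiset.countP_map, Finset.card_def,
      Finset.card_def, Finset.filter_val]
    have : 1 ≤ r S.val.card := hr
    omega
  · refine h.imp (fun h => ?_) id
    simp only [Multiset.length_sort, Multiset.card_map, Finset.card_val]
    omega

theorem thresholdOf_eq_zero {r : ℕ → ℕ} {x : ℕ → ℝ} {S : Finset ℕ} (h : S.card < r S.card) :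
    thresholdOf r x S = 0 := by
  unfold thresholdOf
  apply List.getD_eq_default
  simp only [Multiset.length_sort, Multiset.card_map, Finset.card_val]
  omega

theorem exists_thresholdOf_eq {r : ℕ → ℕ} {x : ℕ → ℝ} {S : Finset ℕ} (hr : 1 ≤ r S.card)
    (h : r S.card ≤ S.card) : ∃ i ∈ S, thresholdOf r x S = x i := by
  have hlt : r S.card - 1 < ((S.val.map x).sort (· ≥ ·)).length := by
    simp only [Multiset.length_sort, Multiset.card_map, Finset.card_val]
    omega
  have hmem := List.getElem_mem hlt
  rw [Multiset.mem_sort, Multiset.mem_map] at hmem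
  obtain ⟨i, hi, hix⟩ := hmem
  refine ⟨i, hi, ?_⟩
  rw [hix, thresholdOf, List.getD_eq_getElem]

theorem thresholdOf_nonneg {r : ℕ → ℕ} {x : ℕ → ℝ} {S : Finset ℕ} (hr : 1 ≤ r S.card)
    (hx : ∀ i ∈ S, 0 ≤ x i) : 0 ≤ thresholdOf r x S := by
  rcases lt_or_ge S.card (r S.card) with h | h
  · exact (thresholdOf_eq_zero h).ge
  · obtain ⟨i, hi, h⟩ := exists_thresholdOf_eq (x := x) hr h
    exact h ▸ hx i hi

/-! ### Rank sequences -/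

/-- The rank sequences of the theorem: `r 0 = 1`, and each step is `0` or `1`. -/
def IsRankSeq (r : ℕ → ℕ) : Prop :=
  r 0 = 1 ∧ ∀ m : ℕ, r m ≤ r (m + 1) ∧ r (m + 1) ≤ r m + 1

theorem IsRankSeq.mono {r : ℕ → ℕ} (hr : IsRankSeq r) : Monotone r :=
  monotone_nat_of_le_succ fun m => (hr.2 m).1

theorem IsRankSeq.one_le {r : ℕ → ℕ} (hr : IsRankSeq r) (m : ℕ) : 1 ≤ r m :=
  hr.1 ▸ hr.mono (Nat.zero_le m)

theorem IsRankSeq.le_succ {r : ℕ → ℕ} (hr : IsRankSeq r) (m : ℕ) : r m ≤ m + 1 := by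
  induction m with
  | zero => exact hr.1.le
  | succ m ih => have := (hr.2 m).2; omega

theorem IsRankSeq.eq_or {r : ℕ → ℕ} (hr : IsRankSeq r) (m : ℕ) :
    r (m + 1) = r m ∨ r (m + 1) = r m + 1 := by
  have := hr.2 m; omega

theorem IsRankSeq.step_le {r : ℕ → ℕ} (hr : IsRankSeq r) {m k : ℕ} (hmk : m ≤ k) :
    r k ≤ r m + (k - m) := by
  induction k, hmk using Nat.le_induction with
  | base => simp
  | succ k hk ih => have := (hr.2 k).2; omega

/-! ### Pathwise evolution of the accepted set and the threshold -/

/-- The threshold in force after the candidates `1, …, n` have been examined. -/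
noncomputable def currentThreshold (r : ℕ → ℕ) (x : ℕ → ℝ) (n : ℕ) : ℝ :=
  thresholdOf r x (accepted r x n)

theorem accepted_succ (r : ℕ → ℕ) (x : ℕ → ℝ) (n : ℕ) :
    accepted r x (n + 1) = if currentThreshold r x n < x (n + 1)
      then insert (n + 1) (accepted r x n) else accepted r x n := rfl

theorem accepted_subset (r : ℕ → ℕ) (x : ℕ → ℝ) (n : ℕ) :
    accepted r x n ⊆ Finset.Icc 1 n := by
  induction n with
  | zero => simp [accepted]
  | succ n ih =>
    have h : Finset.Icc 1 n ⊆ Finset.Icc 1 (n + 1) := Finset.Icc_subset_Icc_right (by omega)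
    rw [accepted_succ]
    split_ifs
    · exact Finset.insert_subset (by simp) (ih.trans h)
    · exact ih.trans h

theorem accepted_mono (r : ℕ → ℕ) (x : ℕ → ℝ) : Monotone (accepted r x) := by
  refine monotone_nat_of_le_succ fun n => ?_
  rw [accepted_succ]
  split_ifs
  · exact Finset.subset_insert _ _
  · exact le_rfl

theorem succ_notMem_accepted (r : ℕ → ℕ) (x : ℕ → ℝ) (n : ℕ) : n + 1 ∉ accepted r x n := by
  intro h
  have := Finset.mem_Icc.mp (accepted_subset r x n h)
  omega

theorem numAccepted_mono (r : ℕ → ℕ) (x : ℕ → ℝ) : Monotone (numAccepted r x) :=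
  fun _ _ h => Finset.card_le_card (accepted_mono r x h)

theorem numAccepted_zero (r : ℕ → ℕ) (x : ℕ → ℝ) : numAccepted r x 0 = 0 := rfl

theorem numAccepted_succ_of_lt {r : ℕ → ℕ} {x : ℕ → ℝ} {n : ℕ}
    (h : currentThreshold r x n < x (n + 1)) :
    numAccepted r x (n + 1) = numAccepted r x n + 1 := by
  rw [numAccepted, accepted_succ, if_pos h, Finset.card_insert_of_notMem
    (succ_notMem_accepted r x n), numAccepted]

theorem numAccepted_succ_of_not_lt {r : ℕ → ℕ} {x : ℕ → ℝ} {n : ℕ}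
    (h : ¬ currentThreshold r x n < x (n + 1)) :
    numAccepted r x (n + 1) = numAccepted r x n := by
  rw [numAccepted, accepted_succ, if_neg h, numAccepted]

theorem accepted_pos {r : ℕ → ℕ} {x : ℕ → ℝ} (hx : ∀ k, 0 < x (k + 1)) {n i : ℕ}
    (hi : i ∈ accepted r x n) : 0 < x i := by
  have := Finset.mem_Icc.mp (accepted_subset r x n hi)
  have h := hx (i - 1)
  rwa [Nat.sub_add_cancel this.1] at h

theorem currentThreshold_nonneg {r : ℕ → ℕ} (hr : IsRankSeq r) {x : ℕ → ℝ}
    (hx : ∀ k, 0 < x (k + 1)) (n : ℕ) : 0 ≤ currentThreshold r x n :=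
  thresholdOf_nonneg (hr.one_le _) fun _ hi => (accepted_pos hx hi).le

theorem currentThreshold_le_iff {r : ℕ → ℕ} (hr : IsRankSeq r) {x : ℕ → ℝ} {n : ℕ} {s : ℝ}
    (hs : 0 ≤ s) : currentThreshold r x n ≤ s ↔
      ((accepted r x n).filter (fun i => s < x i)).card < r (numAccepted r x n) :=
  thresholdOf_le_iff (hr.one_le _) (Or.inr hs)

theorem filter_accepted_succ {r : ℕ → ℕ} {x : ℕ → ℝ} {n : ℕ}
    (h : currentThreshold r x n < x (n + 1)) (s : ℝ) :
    ((accepted r x (n + 1)).filter (fun i => s < x i)).card =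
      ((accepted r x n).filter (fun i => s < x i)).card + if s < x (n + 1) then 1 else 0 := by
  rw [accepted_succ, if_pos h, Finset.filter_insert]
  split_ifs
  · rw [Finset.card_insert_of_notMem]
    exact fun hmem => succ_notMem_accepted r x n (Finset.mem_filter.mp hmem).1
  · rfl

/-- Let `s` be the new threshold. Fewer than `r (m + 1) ≤ r m + 1` accepted values exceed `s`. If
the newcomer is one of them, removing her leaves fewer than `r m`; otherwise `s` is at least her
value, which is above the old threshold. -/
theorem currentThreshold_le_succ {r : ℕ → ℕ} (hr : IsRankSeq r) {x : ℕ → ℝ}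
    (hx : ∀ k, 0 < x (k + 1)) (n : ℕ) :
    currentThreshold r x n ≤ currentThreshold r x (n + 1) := by
  by_cases h : currentThreshold r x n < x (n + 1)
  · have hs := currentThreshold_nonneg hr hx (n + 1)
    have h1 := (currentThreshold_le_iff hr hs).mp le_rfl
    rw [filter_accepted_succ h, numAccepted_succ_of_lt h] at h1
    by_cases h2 : currentThreshold r x (n + 1) < x (n + 1)
    · rw [if_pos h2] at h1
      have := (hr.2 (numAccepted r x n)).2
      exact (currentThreshold_le_iff hr hs).mpr (by omega)
    · exact h.le.trans (not_lt.mp h2)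
  · rw [currentThreshold, currentThreshold, accepted_succ, if_neg h]

theorem currentThreshold_mono {r : ℕ → ℕ} (hr : IsRankSeq r) {x : ℕ → ℝ}
    (hx : ∀ k, 0 < x (k + 1)) : Monotone (currentThreshold r x) :=
  monotone_nat_of_le_succ (currentThreshold_le_succ hr hx)

/-- The newcomer moves the old threshold value down one place in the ordering, which the larger rank
compensates. -/
theorem currentThreshold_succ_of_rank_succ {r : ℕ → ℕ} (hr : IsRankSeq r) {x : ℕ → ℝ}
    (hx : ∀ k, 0 < x (k + 1)) {n : ℕ} (h : currentThreshold r x n < x (n + 1))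
    (hup : r (numAccepted r x n + 1) = r (numAccepted r x n) + 1) :
    currentThreshold r x (n + 1) = currentThreshold r x n := by
  refine le_antisymm ?_ (currentThreshold_le_succ hr hx n)
  have hs := currentThreshold_nonneg hr hx n
  rw [currentThreshold_le_iff hr hs, filter_accepted_succ h, numAccepted_succ_of_lt h, hup,
    if_pos h]
  have := (currentThreshold_le_iff hr hs).mp le_rfl
  omega

/-- The `k < n` such that the candidate `k + 1` has a value above the current threshold. -/
noncomputable def above (r : ℕ → ℕ) (x : ℕ → ℝ) (n : ℕ) : Finset ℕ :=
  (Finset.range n).filter (fun k => currentThreshold r x n < x (k + 1))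

theorem succ_mem_accepted {r : ℕ → ℕ} (hr : IsRankSeq r) {x : ℕ → ℝ}
    (hx : ∀ k, 0 < x (k + 1)) {n k : ℕ} (hk : k < n)
    (h : currentThreshold r x n < x (k + 1)) : k + 1 ∈ accepted r x n := by
  refine accepted_mono r x hk ?_
  rw [accepted_succ, if_pos ((currentThreshold_mono hr hx hk.le).trans_lt h)]
  exact Finset.mem_insert_self _ _

/-- Every candidate whose value exceeds some `s` that is at least the current threshold has been
accepted. -/
theorem filter_accepted_eq {r : ℕ → ℕ} (hr : IsRankSeq r) {x : ℕ → ℝ}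
    (hx : ∀ k, 0 < x (k + 1)) {n : ℕ} {s : ℝ} (hs : currentThreshold r x n ≤ s) :
    ((accepted r x n).filter (fun i => s < x i)).card =
      ((Finset.range n).filter (fun k => s < x (k + 1))).card := by
  rw [← Finset.card_map (addRightEmbedding 1) (s := (Finset.range n).filter _)]
  congr 1
  ext i
  simp only [Finset.mem_filter, Finset.mem_map, Finset.mem_range, addRightEmbedding_apply]
  constructor
  · rintro ⟨hi, hsi⟩
    have := Finset.mem_Icc.mp (accepted_subset r x n hi)
    have he : i - 1 + 1 = i := by omega
    exact ⟨i - 1, ⟨by omega, by rwa [he]⟩, he⟩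
  · rintro ⟨k, ⟨hk, hsk⟩, rfl⟩
    exact ⟨succ_mem_accepted hr hx hk (hs.trans_lt hsk), hsk⟩

theorem card_filter_lt_of_currentThreshold_le {r : ℕ → ℕ} (hr : IsRankSeq r) {x : ℕ → ℝ}
    (hx : ∀ k, 0 < x (k + 1)) {n : ℕ} {s : ℝ} (hs : currentThreshold r x n ≤ s) :
    ((Finset.range n).filter (fun k => s < x (k + 1))).card < r (numAccepted r x n) := by
  rw [← filter_accepted_eq hr hx hs]
  exact (currentThreshold_le_iff hr ((currentThreshold_nonneg hr hx n).trans hs)).mp hs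

/-- The hypothesis `hm` excludes the default threshold 0, for which a negative `s` could violate the
bound. -/
theorem le_card_filter_of_lt_currentThreshold {r : ℕ → ℕ} (hr : IsRankSeq r) {x : ℕ → ℝ}
    {n : ℕ} {s : ℝ} (hm : r (numAccepted r x n) ≤ numAccepted r x n)
    (hs : s < currentThreshold r x n) :
    r (numAccepted r x n) ≤ ((Finset.range n).filter (fun k => s < x (k + 1))).card := by
  have h := (thresholdOf_le_iff (x := x) (s := s) (hr.one_le _) (Or.inl hm)).not.mp hs.not_ge
  refine (not_lt.mp h).trans ?_
  rw [← Finset.card_map (addRightEmbedding 1) (s := (Finset.range n).filter _)]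
  refine Finset.card_le_card fun i hi => ?_
  rw [Finset.mem_filter] at hi
  have := Finset.mem_Icc.mp (accepted_subset r x n hi.1)
  have he : i - 1 + 1 = i := by omega
  simp only [Finset.mem_filter, Finset.mem_map, Finset.mem_range, addRightEmbedding_apply]
  exact ⟨i - 1, ⟨by omega, by rw [he]; exact hi.2⟩, he⟩

/-- This count fixes the rate of the next exponential increment: with the newcomer, `r m` values
compete for the minimum. Distinctness of the values is needed, since ties at the threshold would
lower the count. -/
theorem card_above {r : ℕ → ℕ} (hr : IsRankSeq r) {x : ℕ → ℝ}
    (hx : ∀ k, 0 < x (k + 1)) (hinj : Function.Injective fun k => x (k + 1)) (n : ℕ) :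
    (above r x n).card + 1 = r (numAccepted r x n) := by
  have hlt : (above r x n).card < _ := card_filter_lt_of_currentThreshold_le hr hx le_rfl
  refine le_antisymm hlt ?_
  rcases lt_or_ge (accepted r x n).card (r (accepted r x n).card) with h | h
  · have h0 : currentThreshold r x n = 0 := thresholdOf_eq_zero h
    have h1 : (above r x n).card = (accepted r x n).card := by
      rw [above, ← filter_accepted_eq hr hx le_rfl, Finset.filter_true_of_mem]
      intro i hi
      rw [h0]
      exact accepted_pos hx hi
    rw [h1]
    exact hr.le_succ _
  -- Take `s` so close below the threshold that no examined value lies strictly between them. At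
  -- least `r m` values exceed `s`, and by injectivity only one of them equals the threshold. The
  -- entry `currentThreshold r x n - 1` merely keeps `V` nonempty.
  · obtain ⟨s, hs, hs'⟩ : ∃ s < currentThreshold r x n, ∀ k < n,
        x (k + 1) < currentThreshold r x n → x (k + 1) ≤ s := by
      set V := insert (currentThreshold r x n - 1) (((Finset.range n).filter
        (fun k => x (k + 1) < currentThreshold r x n)).image fun k => x (k + 1)) with hV
      have hne : V.Nonempty := Finset.insert_nonempty _ _
      refine ⟨V.max' hne, ?_, fun k hk hkx => Finset.le_max' _ _ ?_⟩
      · rw [Finset.max'_lt_iff]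
        intro v hv
        rw [hV, Finset.mem_insert, Finset.mem_image] at hv
        rcases hv with rfl | ⟨k, hk, rfl⟩
        · linarith
        · exact (Finset.mem_filter.mp hk).2
      · rw [hV, Finset.mem_insert, Finset.mem_image]
        exact Or.inr ⟨k, Finset.mem_filter.mpr ⟨Finset.mem_range.mpr hk, hkx⟩, rfl⟩
    obtain ⟨i, hi, hiT⟩ := exists_thresholdOf_eq (x := x) (hr.one_le _) h
    change currentThreshold r x n = x i at hiT
    have hin := Finset.mem_Icc.mp (accepted_subset r x n hi)
    refine (le_card_filter_of_lt_currentThreshold hr h hs).trans ?_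
    refine (Finset.card_le_card (t := insert (i - 1) (above r x n)) fun k hk => ?_).trans
      (Finset.card_insert_le _ _)
    rw [Finset.mem_filter, Finset.mem_range] at hk
    rw [Finset.mem_insert, above, Finset.mem_filter, Finset.mem_range]
    rcases lt_trichotomy (x (k + 1)) (currentThreshold r x n) with h1 | h1 | h1
    · exact absurd (hs' k hk.1 h1) hk.2.not_ge
    · left
      apply hinj
      simp only [Nat.sub_add_cancel hin.1]
      exact h1.trans hiT
    · exact Or.inr ⟨hk.1, h1⟩

/-- If the rank does not change at an acceptance, the new threshold is the smallest value above
the old one. -/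
theorem currentThreshold_succ_of_rank_eq {r : ℕ → ℕ} (hr : IsRankSeq r) {x : ℕ → ℝ}
    (hx : ∀ k, 0 < x (k + 1)) (hinj : Function.Injective fun k => x (k + 1)) {n : ℕ}
    (h : currentThreshold r x n < x (n + 1))
    (hst : r (numAccepted r x n + 1) = r (numAccepted r x n)) :
    currentThreshold r x (n + 1) =
      (insert n (above r x n)).inf' (Finset.insert_nonempty _ _) (fun k => x (k + 1)) := by
  set A := (insert n (above r x n)).inf' (Finset.insert_nonempty _ _) (fun k => x (k + 1)) with hA
  have hAT : currentThreshold r x n < A := by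
    rw [hA, Finset.lt_inf'_iff]
    intro k hk
    rcases Finset.mem_insert.mp hk with rfl | hk
    · exact h
    · exact (Finset.mem_filter.mp hk).2
  have hcard : (insert n (above r x n)).card = r (numAccepted r x n) := by
    rw [← card_above hr hx hinj, Finset.card_insert_of_notMem]
    simp [above]
  have hA0 : 0 ≤ A := (currentThreshold_nonneg hr hx n).trans hAT.le
  -- Above a level `s` at or over the old threshold, the accepted values are exactly those from
  -- `insert n (above r x n)`. This set has `r m` elements, so the new threshold is at most `s` iff
  -- not all of them exceed `s`.
  have key : ∀ s, currentThreshold r x n ≤ s → (currentThreshold r x (n + 1) ≤ s ↔ A ≤ s) := by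
    intro s hs
    have hs0 := (currentThreshold_nonneg hr hx n).trans hs
    have e : (accepted r x (n + 1)).filter (fun i => s < x i) =
        ((insert n (above r x n)).filter (fun k => s < x (k + 1))).map (addRightEmbedding 1) := by
      ext i
      simp only [Finset.mem_filter, Finset.mem_map, addRightEmbedding_apply]
      constructor
      · rintro ⟨hi, hsi⟩
        have := Finset.mem_Icc.mp (accepted_subset r x _ hi)
        have he : i - 1 + 1 = i := by omega
        refine ⟨i - 1, ⟨?_, by rwa [he]⟩, he⟩
        rw [Finset.mem_insert, above, Finset.mem_filter, Finset.mem_range, he]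
        rcases eq_or_ne i (n + 1) with hi' | hi'
        · left; omega
        · exact Or.inr ⟨by omega, hs.trans_lt hsi⟩
      · rintro ⟨k, ⟨hk, hsk⟩, rfl⟩
        refine ⟨?_, hsk⟩
        rw [accepted_succ, if_pos h, Finset.mem_insert]
        rcases Finset.mem_insert.mp hk with rfl | hk
        · exact Or.inl rfl
        · have hk := Finset.mem_filter.mp hk
          exact Or.inr (succ_mem_accepted hr hx (Finset.mem_range.mp hk.1) hk.2)
    rw [currentThreshold_le_iff hr hs0, numAccepted_succ_of_lt h, hst, e, Finset.card_map,
      ← hcard, hA, Finset.inf'_le_iff, (Finset.card_filter_le _ _).lt_iff_ne, Ne,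
      Finset.card_filter_eq_iff]
    simp only [not_forall, not_lt, exists_prop]
  exact le_antisymm ((key A hAT.le).mpr le_rfl)
    ((key _ (currentThreshold_le_succ hr hx n)).mp le_rfl)

/-- Changing values above the current threshold to other values above it changes neither the
accepted candidates nor the threshold. -/
theorem accepted_eq_of_eq_or_lt {r : ℕ → ℕ} (hr : IsRankSeq r) {x x' : ℕ → ℝ}
    (hx : ∀ k, 0 < x (k + 1)) (hx' : ∀ k, 0 < x' (k + 1)) {n : ℕ}
    (h : ∀ k < n, x (k + 1) = x' (k + 1) ∨
      (currentThreshold r x n < x (k + 1) ∧ currentThreshold r x n < x' (k + 1))) :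
    accepted r x' n = accepted r x n ∧ currentThreshold r x' n = currentThreshold r x n := by
  have hT : ∀ k ≤ n, accepted r x' k = accepted r x k →
      currentThreshold r x' k = currentThreshold r x k := by
    intro k hk he
    have hkn := currentThreshold_mono hr hx hk
    -- Levels up to the final threshold do not see the changed values. The criterion is applied at
    -- the threshold of `x`, and then at that of `x'`, which the first application shows to be such
    -- a level.
    have iff : ∀ s, 0 ≤ s → s ≤ currentThreshold r x n →
        (currentThreshold r x' k ≤ s ↔ currentThreshold r x k ≤ s) := by
      intro s hs0 hs
      rw [currentThreshold_le_iff hr hs0, currentThreshold_le_iff hr hs0, numAccepted, numAccepted,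
        he]
      have : (accepted r x k).filter (fun i => s < x' i) =
          (accepted r x k).filter (fun i => s < x i) := by
        refine Finset.filter_congr fun i hi => ?_
        have hik := Finset.mem_Icc.mp (accepted_subset r x k hi)
        have hh := h (i - 1) (by omega)
        rw [Nat.sub_add_cancel hik.1] at hh
        rcases hh with hh | hh
        · rw [hh]
        · exact iff_of_true (hs.trans_lt hh.2) (hs.trans_lt hh.1)
      rw [this]
    have h1 := (iff _ (currentThreshold_nonneg hr hx k) hkn).mpr le_rfl
    exact le_antisymm h1
      ((iff _ (currentThreshold_nonneg hr hx' k) (h1.trans hkn)).mp le_rfl)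
  have hS : ∀ k ≤ n, accepted r x' k = accepted r x k := by
    intro k
    induction k with
    | zero => intro _; rfl
    | succ k ih =>
      intro hk
      have ihk := ih (by omega)
      have hTk := hT k (by omega) ihk
      have hkn := currentThreshold_mono hr hx (show k ≤ n by omega)
      have : currentThreshold r x' k < x' (k + 1) ↔ currentThreshold r x k < x (k + 1) := by
        rw [hTk]
        rcases h k (by omega) with hh | hh
        · rw [hh]
        · exact iff_of_true (hkn.trans_lt hh.2) (hkn.trans_lt hh.1)
      simp only [accepted_succ, ihk, this]
  exact ⟨hS n le_rfl, hT n le_rfl (hS n le_rfl)⟩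

/-- If the values are unbounded, then infinitely many candidates are accepted. -/
theorem exists_le_numAccepted {r : ℕ → ℕ} {x : ℕ → ℝ}
    (hx : ∀ (n : ℕ) (C : ℝ), ∃ k ≥ n, C < x (k + 1)) (m : ℕ) :
    ∃ n, m ≤ numAccepted r x n := by
  induction m with
  | zero => exact ⟨0, Nat.zero_le _⟩
  | succ m ih =>
    obtain ⟨n, hn⟩ := ih
    by_contra! hcon
    have hst : ∀ k ≥ n, accepted r x k = accepted r x n := by
      intro k hk
      refine (Finset.eq_of_subset_of_card_le (accepted_mono r x hk) ?_).symm
      have := hcon k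
      simp only [numAccepted] at this hn
      omega
    obtain ⟨k, hk, hkx⟩ := hx n (currentThreshold r x n)
    have hlt : currentThreshold r x k < x (k + 1) := by
      rwa [currentThreshold, hst k hk]
    have h1 := numAccepted_succ_of_lt hlt
    have h2 := hcon (k + 1)
    have h3 := numAccepted_mono r x hk
    omega

theorem numAccepted_acceptIndex {r : ℕ → ℕ} {x : ℕ → ℝ} {m : ℕ}
    (hm : ∃ n, m ≤ numAccepted r x n) : numAccepted r x (acceptIndex r x m) = m := by
  have hmem : m ≤ numAccepted r x (acceptIndex r x m) := Nat.sInf_mem hm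
  refine le_antisymm ?_ hmem
  rcases h : acceptIndex r x m with _ | n
  · rw [numAccepted_zero]; omega
  · have hn : numAccepted r x n < m := by
      by_contra! hcon
      have : acceptIndex r x m ≤ n := Nat.sInf_le hcon
      omega
    by_cases hlt : currentThreshold r x n < x (n + 1)
    · rw [numAccepted_succ_of_lt hlt]; omega
    · rw [numAccepted_succ_of_not_lt hlt]; omega

/-- Between acceptances the accepted set is constant, so any time with `m` acceptances may replace
the first one. -/
theorem threshold_eq {r : ℕ → ℕ} {x : ℕ → ℝ} {n m : ℕ} (hm : numAccepted r x n = m) :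
    threshold r x m = currentThreshold r x n := by
  have hle : acceptIndex r x m ≤ n := Nat.sInf_le hm.ge
  have hN := numAccepted_acceptIndex ⟨n, hm.ge⟩
  rw [threshold, currentThreshold]
  congr 1
  refine Finset.eq_of_subset_of_card_le (accepted_mono r x hle) ?_
  rw [← numAccepted, ← numAccepted, hN, hm]

/-- The candidate who is accepted as number `m + 1`. -/
theorem exists_accept {r : ℕ → ℕ} {x : ℕ → ℝ} {m : ℕ} (hm : ∃ n, m + 1 ≤ numAccepted r x n) :
    ∃ n, numAccepted r x n = m ∧ currentThreshold r x n < x (n + 1) := by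
  have hN := numAccepted_acceptIndex hm
  rcases h : acceptIndex r x (m + 1) with _ | n
  · rw [h, numAccepted_zero] at hN; omega
  · rw [h] at hN
    have hn : numAccepted r x n < m + 1 := by
      by_contra! hcon
      have : acceptIndex r x (m + 1) ≤ n := Nat.sInf_le hcon
      omega
    by_cases hlt : currentThreshold r x n < x (n + 1)
    · rw [numAccepted_succ_of_lt hlt] at hN
      exact ⟨n, by omega, hlt⟩
    · rw [numAccepted_succ_of_not_lt hlt] at hN; omega

end Hiring

namespace Hiring

/-! ### Measurability -/

section Measurability

variable {α : Type*} [MeasurableSpace α] {r : ℕ → ℕ} {x : α → ℕ → ℝ}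

/-- The condition on `S` keeps index 0 out, where nothing is assumed about `x`. -/
theorem measurable_thresholdOf (hr : IsRankSeq r) (hx : ∀ k, Measurable fun a => x a (k + 1))
    {n : ℕ} {S : Finset ℕ} (hS : S ⊆ Finset.Icc 1 n) :
    Measurable fun a => thresholdOf r (x a) S := by
  rcases lt_or_ge S.card (r S.card) with h | h
  · simp only [thresholdOf_eq_zero h, measurable_const]
  · refine measurable_of_Iic fun s => ?_
    have : (fun a => thresholdOf r (x a) S) ⁻¹' Set.Iic s =
        (fun a => ∑ i ∈ S, if s < x a i then 1 else 0) ⁻¹' Set.Iio (r S.card) := by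
      ext a
      simp only [Set.mem_preimage, Set.mem_Iic, Set.mem_Iio, Finset.sum_boole, Nat.cast_id]
      exact thresholdOf_le_iff (hr.one_le _) (Or.inl h)
    rw [this]
    refine Finset.measurable_fun_sum _ (fun i hi => ?_) measurableSet_Iio
    have hi1 := Finset.mem_Icc.mp (hS hi)
    have hxi := hx (i - 1)
    rw [Nat.sub_add_cancel hi1.1] at hxi
    exact Measurable.ite (measurableSet_lt measurable_const hxi) measurable_const measurable_const

theorem measurable_comp_of_measurableSet_accepted {β : Type*} [MeasurableSpace β] {n : ℕ}
    (hacc : ∀ S, MeasurableSet {a | accepted r (x a) n = S}) {g : Finset ℕ → α → β}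
    (hg : ∀ S ⊆ Finset.Icc 1 n, Measurable (g S)) :
    Measurable fun a => g (accepted r (x a) n) a := by
  intro B hB
  have : (fun a => g (accepted r (x a) n) a) ⁻¹' B =
      ⋃ S ∈ (Finset.Icc 1 n).powerset, {a | accepted r (x a) n = S} ∩ g S ⁻¹' B := by
    ext a
    simp only [Set.mem_preimage, Set.mem_iUnion, Set.mem_inter_iff, Set.mem_ofPred_eq,
      Finset.mem_powerset, exists_prop]
    constructor
    · exact fun h => ⟨_, accepted_subset _ _ _, rfl, h⟩
    · rintro ⟨S, -, rfl, h⟩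
      exact h
  rw [this]
  refine Finset.measurableSet_biUnion _ fun S hS => (hacc S).inter ?_
  exact hg S (Finset.mem_powerset.mp hS) hB

theorem measurableSet_accepted_eq (hr : IsRankSeq r) (hx : ∀ k, Measurable fun a => x a (k + 1))
    (n : ℕ) (S : Finset ℕ) : MeasurableSet {a | accepted r (x a) n = S} := by
  induction n generalizing S with
  | zero => exact MeasurableSet.const (∅ = S)
  | succ n ih =>
    have := measurable_comp_of_measurableSet_accepted (β := Prop) (x := x) (g := fun S' a =>
      (if thresholdOf r (x a) S' < x a (n + 1) then insert (n + 1) S' else S') = S) ih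
    refine measurableSet_setOfPred.mpr (this fun S' hS' => ?_)
    have hlt : MeasurableSet {a | thresholdOf r (x a) S' < x a (n + 1)} :=
      measurableSet_lt (measurable_thresholdOf hr hx hS') (hx n)
    refine measurableSet_setOfPred.mp ?_
    have e : {a | (if thresholdOf r (x a) S' < x a (n + 1) then insert (n + 1) S' else S') = S} =
        ({a | thresholdOf r (x a) S' < x a (n + 1)} ∩ {_a | insert (n + 1) S' = S}) ∪
        ({a | thresholdOf r (x a) S' < x a (n + 1)}ᶜ ∩ {_a | S' = S}) := by
      ext a
      by_cases h : thresholdOf r (x a) S' < x a (n + 1) <;> simp [h]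
    rw [e]
    exact (hlt.inter (MeasurableSet.const _)).union (hlt.compl.inter (MeasurableSet.const _))

theorem measurable_currentThreshold (hr : IsRankSeq r)
    (hx : ∀ k, Measurable fun a => x a (k + 1)) (n : ℕ) :
    Measurable fun a => currentThreshold r (x a) n :=
  measurable_comp_of_measurableSet_accepted (g := fun S a => thresholdOf r (x a) S)
    (measurableSet_accepted_eq hr hx n) fun _ hS => measurable_thresholdOf hr hx hS

theorem measurable_numAccepted (hr : IsRankSeq r)
    (hx : ∀ k, Measurable fun a => x a (k + 1)) (n : ℕ) :
    Measurable fun a => numAccepted r (x a) n :=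
  measurable_comp_of_measurableSet_accepted (g := fun S _ => S.card)
    (measurableSet_accepted_eq hr hx n) fun _ _ => measurable_const

theorem measurableSet_above_eq (hr : IsRankSeq r)
    (hx : ∀ k, Measurable fun a => x a (k + 1)) (n : ℕ) (Q : Finset ℕ) :
    MeasurableSet {a | above r (x a) n = Q} := by
  have : {a | above r (x a) n = Q} = ⋂ k, {a | k ∈ above r (x a) n ↔ k ∈ Q} := by
    ext a
    simp [Finset.ext_iff]
  rw [this]
  refine MeasurableSet.iInter fun k => ?_
  have hk : MeasurableSet {a | k ∈ above r (x a) n} := by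
    simp only [above, Finset.mem_filter, Finset.mem_range]
    exact (MeasurableSet.const _).inter
      (measurableSet_lt (measurable_currentThreshold hr hx n) (hx k))
  by_cases hQ : k ∈ Q
  · simpa only [hQ, iff_true] using hk
  · simp only [hQ, iff_false]
    exact hk.compl

theorem measurable_acceptIndex (hr : IsRankSeq r)
    (hx : ∀ k, Measurable fun a => x a (k + 1)) (m : ℕ) :
    Measurable fun a => acceptIndex r (x a) m := by
  have hM : ∀ n, MeasurableSet {a | m ≤ numAccepted r (x a) n} := fun n =>
    measurableSet_le measurable_const (measurable_numAccepted hr hx n)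
  refine measurable_of_Iio fun k => ?_
  -- If `m` acceptances never occur, the infimum of the empty set is 0, whence the second set of the
  -- union.
  have : (fun a => acceptIndex r (x a) m) ⁻¹' Set.Iio k =
      (⋃ j ∈ Finset.range k, {a | m ≤ numAccepted r (x a) j}) ∪
      ((⋂ j, {a | m ≤ numAccepted r (x a) j}ᶜ) ∩ {_a | 0 < k}) := by
    ext a
    simp only [Set.mem_preimage, Set.mem_Iio, Set.mem_union, Set.mem_iUnion, Set.mem_ofPred_eq,
      Finset.mem_range, exists_prop, Set.mem_inter_iff, Set.mem_iInter, Set.mem_compl_iff]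
    constructor
    · intro h
      by_cases hne : ∃ n, m ≤ numAccepted r (x a) n
      · exact Or.inl ⟨_, h, Nat.sInf_mem hne⟩
      · exact Or.inr ⟨not_exists.mp hne, by omega⟩
    · rintro (⟨j, hj, hjm⟩ | ⟨h, hk⟩)
      · exact lt_of_le_of_lt (Nat.sInf_le hjm : acceptIndex r (x a) m ≤ j) hj
      · have he : {n | m ≤ numAccepted r (x a) n} = ∅ := Set.eq_empty_of_forall_notMem h
        rwa [acceptIndex, he, Nat.sInf_empty]
  rw [this]
  exact (Finset.measurableSet_biUnion _ fun j _ => hM j).union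
    ((MeasurableSet.iInter fun j => (hM j).compl).inter (MeasurableSet.const _))

theorem measurable_threshold (hr : IsRankSeq r)
    (hx : ∀ k, Measurable fun a => x a (k + 1)) (m : ℕ) :
    Measurable fun a => threshold r (x a) m := by
  have h : Measurable fun p : α × ℕ => currentThreshold r (x p.1) p.2 :=
    measurable_from_prod_countable_left fun n => measurable_currentThreshold hr hx n
  exact h.comp (measurable_id.prodMk (measurable_acceptIndex hr hx m))

end Measurability

/-! ### Memorylessness of the exponential law -/

section Exponential

open Set

theorem expMeasure_Ioi {ρ : ℝ} (hρ : 0 < ρ) (s : ℝ) :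
    expMeasure ρ (Ioi s) = ENNReal.ofReal (if 0 ≤ s then Real.exp (-(ρ * s)) else 1) := by
  have := isProbabilityMeasure_expMeasure hρ
  have h := cdf_expMeasure_eq hρ s
  rw [cdf_eq_real] at h
  rw [← compl_Iic, prob_compl_eq_one_sub measurableSet_Iic, ← ofReal_measureReal, h,
    ← ENNReal.ofReal_one, ← ENNReal.ofReal_sub]
  · split_ifs <;> simp
  · split_ifs
    · simpa using by positivity
    · exact le_rfl

theorem ext_of_measure_Ioi {μ ν : Measure ℝ} [IsFiniteMeasure μ]
    (huniv : μ univ = ν univ) (h : ∀ s, μ (Ioi s) = ν (Ioi s)) : μ = ν := by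
  refine ext_of_generate_finite _ (borel_eq_generateFrom_Ioi ℝ ▸ BorelSpace.measurable_eq)
    isPiSystem_Ioi ?_ huniv
  rintro _ ⟨s, rfl⟩
  exact h s

/-- Memorylessness at a fixed level, as an identity of measures; it is verified on the tails `Ioi
s`. -/
theorem expMeasure_restrict_Ioi {ρ t : ℝ} (hρ : 0 < ρ) (ht : 0 ≤ t) :
    (expMeasure ρ).restrict (Ioi t) =
      expMeasure ρ (Ioi t) • (expMeasure ρ).map (fun v => t + v) := by
  have := isProbabilityMeasure_expMeasure hρ
  refine ext_of_measure_Ioi ?_ fun s => ?_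
  · simp [Measure.map_apply (measurable_const_add t)]
  · rw [Measure.restrict_apply measurableSet_Ioi, Ioi_inter_Ioi, Measure.smul_apply,
      Measure.map_apply (measurable_const_add t) measurableSet_Ioi, preimage_const_add_Ioi,
      smul_eq_mul, expMeasure_Ioi hρ, expMeasure_Ioi hρ, expMeasure_Ioi hρ, if_pos ht,
      if_pos (le_trans ht le_sup_right), ← ENNReal.ofReal_mul (Real.exp_pos _).le]
    congr 1
    rcases le_total t s with h | h
    · rw [max_eq_left h, if_pos (sub_nonneg.mpr h), ← Real.exp_add]
      ring_nf
    · rw [max_eq_right h]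
      rcases h.eq_or_lt with rfl | h
      · simp
      · rw [if_neg (by linarith), mul_one]

theorem setLIntegral_expMeasure_Ioi {ρ t : ℝ} (hρ : 0 < ρ) (ht : 0 ≤ t) {f : ℝ → ENNReal}
    (hf : Measurable f) :
    ∫⁻ a in Ioi t, f a ∂expMeasure ρ =
      expMeasure ρ (Ioi t) * ∫⁻ v, f (t + v) ∂expMeasure ρ := by
  rw [expMeasure_restrict_Ioi hρ ht, lintegral_smul_measure,
    lintegral_map hf (measurable_const_add t), smul_eq_mul]

/-- The memoryless property, for a random starting point that is independent of the exponential
variable. -/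
theorem setLIntegral_memoryless {Ω α : Type*} [MeasurableSpace Ω] [MeasurableSpace α]
    {P : Measure Ω} [IsProbabilityMeasure P] {U : Ω → α} {A : Ω → ℝ} (hU : Measurable U)
    (hA : Measurable A) (hUA : IndepFun U A P) {ρ : ℝ} (hρ : 0 < ρ)
    (hlaw : P.map A = expMeasure ρ) {B : Set α} (hB : MeasurableSet B) {τ : α → ℝ}
    (hτ : Measurable τ) (hτ0 : ∀ u ∈ B, 0 ≤ τ u) {f : ℝ → ENNReal} (hf : Measurable f) :
    ∫⁻ ω in {ω | U ω ∈ B ∧ τ (U ω) < A ω}, f (A ω) ∂P =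
      ∫⁻ ω in {ω | U ω ∈ B ∧ τ (U ω) < A ω}, (∫⁻ v, f (τ (U ω) + v) ∂expMeasure ρ) ∂P := by
  have := isProbabilityMeasure_expMeasure hρ
  set E : Set (α × ℝ) := {p | p.1 ∈ B ∧ τ p.1 < p.2} with hE
  have hEm : MeasurableSet E :=
    (measurable_fst hB).inter (measurableSet_lt (hτ.comp measurable_fst) measurable_snd)
  have hpair : Measurable fun ω => (U ω, A ω) := hU.prodMk hA
  have hmap : P.map (fun ω => (U ω, A ω)) = (P.map U).prod (expMeasure ρ) := by
    rw [(indepFun_iff_map_prod_eq_prod_map_map hU.aemeasurable hA.aemeasurable).mp hUA, hlaw]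
  have hK : Measurable fun u : α => ∫⁻ v, f (τ u + v) ∂expMeasure ρ :=
    Measurable.lintegral_prod_right' (f := fun p : α × ℝ => f (τ p.1 + p.2)) (by fun_prop)
  -- Fubini reduces both sides to inner integrals over `Ioi (τ u)`, with `τ u` a fixed level.
  have hgen : ∀ g : α × ℝ → ENNReal, Measurable g →
      ∫⁻ ω in {ω | U ω ∈ B ∧ τ (U ω) < A ω}, g (U ω, A ω) ∂P =
        ∫⁻ u in B, ∫⁻ a in Ioi (τ u), g (u, a) ∂expMeasure ρ ∂(P.map U) := by
    intro g hg
    have h1 : ∫⁻ ω in (fun ω => (U ω, A ω)) ⁻¹' E, g (U ω, A ω) ∂P =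
        ∫⁻ p in E, g p ∂(P.map (fun ω => (U ω, A ω))) :=
      (setLIntegral_map hEm hg hpair).symm
    refine h1.trans ?_
    rw [hmap, ← lintegral_indicator hEm, lintegral_prod _ (hg.indicator hEm).aemeasurable,
      ← lintegral_indicator hB]
    refine lintegral_congr fun u => ?_
    by_cases hu : u ∈ B
    · rw [indicator_of_mem hu, ← lintegral_indicator measurableSet_Ioi]
      refine lintegral_congr fun a => ?_
      simp [indicator, hE, hu]
    · rw [indicator_of_notMem hu]
      simp [indicator, hE, hu]
  rw [hgen (fun p => f p.2) (by fun_prop),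
    hgen (fun p => ∫⁻ v, f (τ p.1 + v) ∂expMeasure ρ) (hK.comp measurable_fst)]
  refine setLIntegral_congr_fun hB fun u hu => ?_
  simp only
  rw [setLIntegral_expMeasure_Ioi hρ (hτ0 u hu) hf, setLIntegral_const, mul_comm]

end Exponential

end Hiring

namespace Hiring

theorem measurable_finset_inf' {α ι : Type*} [MeasurableSpace α] {Q : Finset ι} (hQ : Q.Nonempty)
    {f : ι → α → ℝ} (hf : ∀ i ∈ Q, Measurable (f i)) :
    Measurable fun a => Q.inf' hQ fun i => f i a := by
  refine measurable_of_Ioi fun s => ?_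
  have : (fun a => Q.inf' hQ fun i => f i a) ⁻¹' Set.Ioi s = ⋂ i ∈ Q, f i ⁻¹' Set.Ioi s := by
    ext a
    simp [Finset.lt_inf'_iff]
  rw [this]
  exact Finset.measurableSet_biInter _ fun i hi => hf i hi measurableSet_Ioi

/-! ### The law of the threshold -/

section ThresholdLaw

variable {Ω : Type*} [MeasurableSpace Ω] {P : Measure Ω} {r : ℕ → ℕ} {X : ℕ → Ω → ℝ}

theorem measure_lt_eq (hX : ∀ k, Measurable (X (k + 1)))
    (hlaw : ∀ k, P.map (X (k + 1)) = expMeasure 1) (k : ℕ) (s : ℝ) :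
    P {ω | s < X (k + 1) ω} = ENNReal.ofReal (if 0 ≤ s then Real.exp (-s) else 1) := by
  have h := Measure.map_apply (μ := P) (hX k) (measurableSet_Ioi (a := s))
  rw [hlaw, expMeasure_Ioi one_pos, one_mul] at h
  exact h.symm

variable [IsProbabilityMeasure P]

theorem map_inf'_eq_expMeasure (hX : ∀ k, Measurable (X (k + 1)))
    (hlaw : ∀ k, P.map (X (k + 1)) = expMeasure 1) (hind : iIndepFun (fun k => X (k + 1)) P)
    {Q : Finset ℕ} (hQ : Q.Nonempty) :
    P.map (fun ω => Q.inf' hQ fun k => X (k + 1) ω) = expMeasure Q.card := by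
  have hmeas : Measurable fun ω => Q.inf' hQ fun k => X (k + 1) ω :=
    measurable_finset_inf' hQ fun k _ => hX k
  have hpos : (0 : ℝ) < Q.card := by exact_mod_cast hQ.card_pos
  have := isProbabilityMeasure_expMeasure hpos
  have := Measure.isProbabilityMeasure_map (μ := P) hmeas.aemeasurable
  refine ext_of_measure_Ioi (by simp) fun s => ?_
  rw [Measure.map_apply hmeas measurableSet_Ioi, expMeasure_Ioi hpos]
  have e : (fun ω => Q.inf' hQ fun k => X (k + 1) ω) ⁻¹' Set.Ioi s =
      ⋂ k ∈ Q, X (k + 1) ⁻¹' Set.Ioi s := by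
    ext ω
    simp [Finset.lt_inf'_iff]
  rw [e, hind.measure_inter_preimage_eq_mul Q (fun _ _ => measurableSet_Ioi)]
  have : ∀ k, P (X (k + 1) ⁻¹' Set.Ioi s) = _ := fun k => measure_lt_eq hX hlaw k s
  rw [Finset.prod_congr rfl fun k _ => this k, Finset.prod_const,
    ← ENNReal.ofReal_pow (by split_ifs <;> positivity)]
  congr 1
  split_ifs
  · rw [← Real.exp_nat_mul]; ring_nf
  · simp

theorem ae_pos (hX : ∀ k, Measurable (X (k + 1)))
    (hlaw : ∀ k, P.map (X (k + 1)) = expMeasure 1) :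
    ∀ᵐ ω ∂P, ∀ k, 0 < X (k + 1) ω := by
  refine ae_all_iff.mpr fun k => ?_
  refine (mem_ae_iff_prob_eq_one (measurableSet_lt measurable_const (hX k))).mpr ?_
  simpa using measure_lt_eq hX hlaw k 0

theorem ae_injective (hX : ∀ k, Measurable (X (k + 1)))
    (hlaw : ∀ k, P.map (X (k + 1)) = expMeasure 1) (hind : iIndepFun (fun k => X (k + 1)) P) :
    ∀ᵐ ω ∂P, Function.Injective fun k => X (k + 1) ω := by
  have := isProbabilityMeasure_expMeasure one_pos
  have : NullSingletonClass (expMeasure 1) := nullSingletonClass_withDensity _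
  have h : ∀ i j, i ≠ j → ∀ᵐ ω ∂P, X (i + 1) ω ≠ X (j + 1) ω := by
    intro i j hij
    have hdiag : MeasurableSet {p : ℝ × ℝ | p.1 = p.2} :=
      measurableSet_eq_fun measurable_fst measurable_snd
    have h1 := (indepFun_iff_map_prod_eq_prod_map_map (hX i).aemeasurable
      (hX j).aemeasurable).mp (hind.indepFun hij)
    have h2 := Measure.map_apply (μ := P) ((hX i).prodMk (hX j)) hdiag
    rw [h1, hlaw, hlaw, (Measure.measure_prod_null hdiag).mpr] at h2
    · rw [ae_iff]
      simp only [ne_eq, not_not]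
      exact h2.symm
    · refine ae_of_all _ fun a => ?_
      have : Prod.mk a ⁻¹' {p : ℝ × ℝ | p.1 = p.2} = {a} := by
        ext b
        simp [eq_comm]
      simp only [this, measure_singleton, Pi.zero_apply]
  have h' : ∀ᵐ ω ∂P, ∀ i j, i ≠ j → X (i + 1) ω ≠ X (j + 1) ω := by
    simp only [ae_all_iff]
    exact h
  filter_upwards [h'] with ω hω i j hij
  by_contra hne
  exact hω i j hne hij

/-- The second Borel–Cantelli lemma at every natural level: the events are independent with a
constant positive probability. -/
theorem ae_unbounded (hX : ∀ k, Measurable (X (k + 1)))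
    (hlaw : ∀ k, P.map (X (k + 1)) = expMeasure 1) (hind : iIndepFun (fun k => X (k + 1)) P) :
    ∀ᵐ ω ∂P, ∀ (n : ℕ) (C : ℝ), ∃ k ≥ n, C < X (k + 1) ω := by
  have h : ∀ j : ℕ, ∀ᵐ ω ∂P, ∃ᶠ k in atTop, (j : ℝ) < X (k + 1) ω := by
    intro j
    have hm : ∀ k, MeasurableSet {ω | (j : ℝ) < X (k + 1) ω} := fun k =>
      measurableSet_lt measurable_const (hX k)
    have hset : iIndepSet (fun k => {ω | (j : ℝ) < X (k + 1) ω}) P := by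
      rw [iIndepSet_iff_meas_biInter hm]
      intro s
      exact hind.measure_inter_preimage_eq_mul s (sets := fun _ => Set.Ioi (j : ℝ))
        fun _ _ => measurableSet_Ioi
    have h1 := measure_limsup_eq_one hm hset (by
      simp only [measure_lt_eq hX hlaw, Nat.cast_nonneg, if_true]
      exact ENNReal.tsum_const_eq_top_of_ne_zero (by simpa using Real.exp_pos _))
    have h2 := (mem_ae_iff_prob_eq_one (MeasurableSet.measurableSet_limsup hm)).mpr h1
    filter_upwards [h2] with ω hω
    exact mem_limsup_iff_frequently_mem.mp hω
  filter_upwards [ae_all_iff.mpr h] with ω hω n C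
  obtain ⟨j, hj⟩ := exists_nat_gt C
  obtain ⟨k, hk, hkj⟩ := frequently_atTop.mp (hω j) n
  exact ⟨k, hk, hj.trans hkj⟩

/-- The sequence with value `u k` at index `k + 1` for `k ∈ R`, and with a value exceeding all
`|u k|` at all other indices. -/
noncomputable def extendLarge (R : Finset ℕ) (u : R → ℝ) (i : ℕ) : ℝ :=
  if h : i - 1 ∈ R then u ⟨i - 1, h⟩ else 1 + ∑ k, |u k|

theorem extendLarge_of_mem {R : Finset ℕ} (u : R → ℝ) {k : ℕ} (h : k ∈ R) :
    extendLarge R u (k + 1) = u ⟨k, h⟩ := by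
  simp [extendLarge, h]

theorem extendLarge_of_notMem {R : Finset ℕ} (u : R → ℝ) {k : ℕ} (h : k ∉ R) :
    extendLarge R u (k + 1) = 1 + ∑ k, |u k| := by
  simp [extendLarge, h]

theorem measurable_extendLarge (R : Finset ℕ) (i : ℕ) :
    Measurable fun u : R → ℝ => extendLarge R u i := by
  unfold extendLarge
  split_ifs
  · fun_prop
  · fun_prop

/-- A nonzero threshold is itself an examined value not above the threshold, so it occurs in the
sum. Hence the filler value of `extendLarge` lies above the threshold when the values in `above` are
replaced by it. -/
theorem currentThreshold_lt_one_add_sum (hr : IsRankSeq r) {x : ℕ → ℝ} {n : ℕ} :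
    currentThreshold r x n <
      1 + ∑ k : ↥(Finset.range n \ above r x n), |x (k + 1)| := by
  have hsum : 0 ≤ ∑ k : ↥(Finset.range n \ above r x n), |x (k + 1)| :=
    Finset.sum_nonneg fun _ _ => abs_nonneg _
  rcases lt_or_ge (accepted r x n).card (r (accepted r x n).card) with h | h
  · rw [currentThreshold, thresholdOf_eq_zero h]
    linarith
  · obtain ⟨i, hi, hiT⟩ := exists_thresholdOf_eq (x := x) (hr.one_le _) h
    change currentThreshold r x n = x i at hiT
    have hin := Finset.mem_Icc.mp (accepted_subset r x n hi)
    have he : i - 1 + 1 = i := by omega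
    have hmem : i - 1 ∈ Finset.range n \ above r x n := by
      simp only [above, Finset.mem_sdiff, Finset.mem_range, Finset.mem_filter, he, hiT,
        lt_irrefl, and_false, not_false_eq_true, and_true]
      omega
    have := Finset.single_le_sum (f := fun k : ↥(Finset.range n \ above r x n) => |x (k + 1)|)
      (fun _ _ => abs_nonneg _) (Finset.mem_univ ⟨i - 1, hmem⟩)
    simp only [he] at this
    rw [hiT]
    linarith [le_abs_self (x i)]

/-- The values `x (k + 1)`, `k ∈ Q`, are those above the threshold if and only if they exceed the
threshold obtained when they are replaced by large values. -/
theorem above_eq_iff (hr : IsRankSeq r) {x : ℕ → ℝ} (hx : ∀ k, 0 < x (k + 1)) {n m : ℕ}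
    {Q : Finset ℕ} {x' : ℕ → ℝ}
    (hx' : x' = extendLarge (Finset.range n \ Q) fun k => x (k + 1)) :
    (numAccepted r x n = m ∧ above r x n = Q) ↔
      ((numAccepted r x' n = m ∧ above r x' n = Q) ∧
        ∀ k ∈ Q, currentThreshold r x' n < x (k + 1)) := by
  have hpos' : ∀ k, 0 < x' (k + 1) := by
    intro k
    by_cases hk : k ∈ Finset.range n \ Q
    · rw [hx', extendLarge_of_mem _ hk]; exact hx k
    · rw [hx', extendLarge_of_notMem _ hk]; positivity
  have hout : ∀ k < n, k ∉ Q → x' (k + 1) = x (k + 1) := by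
    intro k hk hkQ
    have hk : k ∈ Finset.range n \ Q := by simp [hk, hkQ]
    rw [hx', extendLarge_of_mem _ hk]
  have habove : ∀ {y y' : ℕ → ℝ}, currentThreshold r y' n = currentThreshold r y n →
      (∀ k < n, k ∉ Q → y' (k + 1) = y (k + 1)) → above r y n = Q →
      (∀ k ∈ Q, currentThreshold r y n < y' (k + 1)) → above r y' n = Q := by
    intro y y' hT hyy hab hlt
    ext k
    have hk := Finset.ext_iff.mp hab k
    simp only [above, Finset.mem_filter, Finset.mem_range, hT] at hk ⊢
    by_cases hkQ : k ∈ Q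
    · simp only [hkQ, iff_true] at hk ⊢
      exact ⟨hk.1, hlt k hkQ⟩
    · simp only [hkQ, iff_false] at hk ⊢
      rintro ⟨h1, h2⟩
      rw [hyy k h1 hkQ] at h2
      exact hk ⟨h1, h2⟩
  constructor
  · rintro ⟨hm, hab⟩
    have hgt : ∀ k ∈ Q, currentThreshold r x n < x (k + 1) := by
      intro k hk
      rw [← hab] at hk
      exact (Finset.mem_filter.mp hk).2
    have hgt' : ∀ k ∈ Q, currentThreshold r x n < x' (k + 1) := by
      intro k hk
      rw [hx', extendLarge_of_notMem _ (by simp [hk]), ← hab]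
      exact currentThreshold_lt_one_add_sum hr
    obtain ⟨hacc, hT⟩ := accepted_eq_of_eq_or_lt hr hx hpos' (n := n) fun k hk => by
      by_cases hkQ : k ∈ Q
      · exact Or.inr ⟨hgt k hkQ, hgt' k hkQ⟩
      · exact Or.inl (hout k hk hkQ).symm
    refine ⟨⟨?_, habove hT hout hab hgt'⟩, ?_⟩
    · rw [← hm, numAccepted, hacc, numAccepted]
    · rw [hT]; exact hgt
  · rintro ⟨⟨hm, hab⟩, hgt⟩
    have hgt' : ∀ k ∈ Q, currentThreshold r x' n < x' (k + 1) := by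
      intro k hk
      rw [← hab] at hk
      exact (Finset.mem_filter.mp hk).2
    obtain ⟨hacc, hT⟩ := accepted_eq_of_eq_or_lt hr hpos' hx (n := n) fun k hk => by
      by_cases hkQ : k ∈ Q
      · exact Or.inr ⟨hgt' k hkQ, hgt k hkQ⟩
      · exact Or.inl (hout k hk hkQ)
    refine ⟨?_, habove hT (fun k hk hkQ => (hout k hk hkQ).symm) hab hgt⟩
    rw [← hm, numAccepted, hacc, numAccepted]

/-- On `above = Q`, both thresholds agree. -/
theorem currentThreshold_extendLarge (hr : IsRankSeq r) {x : ℕ → ℝ} (hx : ∀ k, 0 < x (k + 1))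
    {n : ℕ} {Q : Finset ℕ} (hab : above r x n = Q) :
    currentThreshold r (extendLarge (Finset.range n \ Q) fun k => x (k + 1)) n =
      currentThreshold r x n := by
  set x' := extendLarge (Finset.range n \ Q) fun k => x (k + 1) with hx'
  refine (accepted_eq_of_eq_or_lt hr hx (fun k => ?_) fun k hk => ?_).2
  · by_cases hk : k ∈ Finset.range n \ Q
    · rw [hx', extendLarge_of_mem _ hk]; exact hx k
    · rw [hx', extendLarge_of_notMem _ hk]; positivity
  · by_cases hkQ : k ∈ Q
    · right
      constructor
      · rw [← hab] at hkQ
        exact (Finset.mem_filter.mp hkQ).2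
      · rw [hx', extendLarge_of_notMem _ (by simp [hkQ]), ← hab]
        exact currentThreshold_lt_one_add_sum hr
    · have hk : k ∈ Finset.range n \ Q := by simp [hk, hkQ]
      rw [hx', extendLarge_of_mem _ hk]
      exact Or.inl rfl

/-- The contribution of one candidate and one set of large values to the law of the threshold. -/
theorem setLIntegral_accept_above (hr : IsRankSeq r) (hX : ∀ k, Measurable (X (k + 1)))
    (hlaw : ∀ k, P.map (X (k + 1)) = expMeasure 1) (hind : iIndepFun (fun k => X (k + 1)) P)
    {m n : ℕ} (hst : r (m + 1) = r m) {Q : Finset ℕ} (hQ : Q ⊆ Finset.range n)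
    {f : ℝ → ENNReal} (hf : Measurable f) :
    ∫⁻ ω in {ω | (numAccepted r (fun i => X i ω) n = m ∧ above r (fun i => X i ω) n = Q) ∧
        currentThreshold r (fun i => X i ω) n < X (n + 1) ω},
      f (currentThreshold r (fun i => X i ω) (n + 1)) ∂P =
    ∫⁻ ω in {ω | (numAccepted r (fun i => X i ω) n = m ∧ above r (fun i => X i ω) n = Q) ∧
        currentThreshold r (fun i => X i ω) n < X (n + 1) ω},
      (∫⁻ v, f (currentThreshold r (fun i => X i ω) n + v) ∂expMeasure (r m)) ∂P := by
  set E := {ω | (numAccepted r (fun i => X i ω) n = m ∧ above r (fun i => X i ω) n = Q) ∧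
        currentThreshold r (fun i => X i ω) n < X (n + 1) ω} with hE
  -- For any other size of `Q` the event is null by `card_above`.
  by_cases hcard : Q.card + 1 = r m
  swap
  · have hnull : ∀ᵐ ω ∂P, ω ∉ E := by
      filter_upwards [ae_pos hX hlaw, ae_injective hX hlaw hind] with ω h1 h2 hω
      have := card_above (r := r) (x := fun i => X i ω) hr h1 h2 n
      rw [hω.1.2, hω.1.1] at this
      exact hcard this
    have hz : P E = 0 := by
      have h := ae_iff.mp hnull
      simp only [not_not] at h
      exact h
    rw [setLIntegral_measure_zero _ _ hz, setLIntegral_measure_zero _ _ hz]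
  -- The values split into those indexed by `R`, collected in `U`, and the `r m` values indexed by
  -- `insert n Q`, with minimum `A`. By `above_eq_iff` the event becomes, up to a null set, a
  -- condition on `U` together with `τ (U ω) < A ω`, so memorylessness applies to `A`.
  set R := Finset.range n \ Q with hR
  have hnQ : n ∉ Q := fun h => by simpa using hQ h
  set A : Ω → ℝ := fun ω => (insert n Q).inf' (Finset.insert_nonempty _ _) fun k => X (k + 1) ω
    with hA
  set U : Ω → (R → ℝ) := fun ω k => X (k + 1) ω with hU
  have hUm : Measurable U := measurable_pi_lambda _ fun k => hX k
  have hAm : Measurable A := measurable_finset_inf' _ fun k _ => hX k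
  have hcard' : (insert n Q).card = r m := by
    rw [Finset.card_insert_of_notMem hnQ, hcard]
  have hAlaw : P.map A = expMeasure (r m) := by
    rw [hA, map_inf'_eq_expMeasure hX hlaw hind, hcard']
  have hUA : IndepFun U A P := by
    have hd : Disjoint R (insert n Q) := by
      rw [Finset.disjoint_insert_right]
      exact ⟨by simp [hR], Finset.sdiff_disjoint⟩
    have h := hind.indepFun_finset R (insert n Q) hd hX
    let φ : (↥(insert n Q) → ℝ) → ℝ := fun v => (insert n Q).attach.inf'
      (Finset.attach_nonempty_iff.mpr (Finset.insert_nonempty _ _)) fun k => v k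
    have hφ : Measurable φ := measurable_finset_inf' _ fun k _ => measurable_pi_apply k
    have hAφ : A = φ ∘ fun ω (k : ↥(insert n Q)) => X (k + 1) ω := by
      ext ω
      refine eq_of_forall_lt_iff fun c => ?_
      simp only [hA, φ, Function.comp_apply, Finset.lt_inf'_iff, Finset.mem_attach, true_implies,
        Subtype.forall]
    rw [hAφ]
    exact h.comp measurable_id hφ
  set τ : (R → ℝ) → ℝ := fun u => currentThreshold r (extendLarge R u) n with hτ
  have hem : ∀ k, Measurable fun u : R → ℝ => extendLarge R u (k + 1) :=
    fun k => measurable_extendLarge R (k + 1)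
  have hτm : Measurable τ := measurable_currentThreshold hr hem n
  -- The condition `0 ≤ τ u` is almost surely automatic, but memorylessness requires it for every
  -- `u` in `B`, including vectors with negative entries.
  set B : Set (R → ℝ) := {u | (numAccepted r (extendLarge R u) n = m ∧
    above r (extendLarge R u) n = Q) ∧ 0 ≤ τ u} with hB
  have hBm : MeasurableSet B :=
    ((measurable_numAccepted hr hem n (measurableSet_singleton m)).inter
      (measurableSet_above_eq hr hem n Q)).inter (measurableSet_le measurable_const hτm)
  have hmain := setLIntegral_memoryless hUm hAm hUA (by exact_mod_cast hr.one_le m) hAlaw hBm hτm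
    (fun u hu => hu.2) hf
  set E' := {ω | U ω ∈ B ∧ τ (U ω) < A ω} with hE'
  have hE'm : MeasurableSet E' :=
    (hUm hBm).inter (measurableSet_lt (hτm.comp hUm) hAm)
  have hEE : ∀ᵐ ω ∂P, ω ∈ E' ↔ ω ∈ E := by
    filter_upwards [ae_pos hX hlaw] with ω hpos
    set x : ℕ → ℝ := fun i => X i ω with hx
    have h1 := above_eq_iff (r := r) (m := m) (x := x) (n := n) (Q := Q) hr hpos rfl
    have hUx : extendLarge R (U ω) = extendLarge (Finset.range n \ Q) fun k => x (k + 1) := rfl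
    simp only [hE', hE, hB, hτ, Set.mem_ofPred_eq, hUx]
    rw [h1, hA]
    simp only [Finset.lt_inf'_iff, Finset.forall_mem_insert]
    constructor
    · rintro ⟨⟨h2, h3⟩, h4, h5⟩
      refine ⟨⟨h2, h5⟩, ?_⟩
      rw [← currentThreshold_extendLarge hr hpos (h1.mpr ⟨h2, h5⟩).2]
      exact h4
    · rintro ⟨⟨h2, h5⟩, h4⟩
      have h6 := currentThreshold_extendLarge hr hpos (h1.mpr ⟨h2, h5⟩).2
      rw [← h6] at h4
      exact ⟨⟨h2, h6 ▸ currentThreshold_nonneg hr hpos n⟩, h4, h5⟩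
  have hEE' : E' =ᵐ[P] E := by
    filter_upwards [hEE] with ω h
    exact propext h
  rw [← setLIntegral_congr hEE', ← setLIntegral_congr hEE']
  refine Eq.trans ?_ (hmain.trans ?_)
  · refine setLIntegral_congr_fun_ae hE'm ?_
    filter_upwards [hEE, ae_pos hX hlaw, ae_injective hX hlaw hind] with ω h hpos hinj hω
    have hω := h.mp hω
    rw [currentThreshold_succ_of_rank_eq hr hpos hinj hω.2 (by rw [hω.1.1, hst])]
    simp only [hA, hω.1.2]
  · refine setLIntegral_congr_fun_ae hE'm ?_
    filter_upwards [hEE, ae_pos hX hlaw] with ω h hpos hω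
    have hω := h.mp hω
    rw [← currentThreshold_extendLarge hr hpos hω.1.2]

theorem setLIntegral_accept (hr : IsRankSeq r) (hX : ∀ k, Measurable (X (k + 1)))
    (hlaw : ∀ k, P.map (X (k + 1)) = expMeasure 1) (hind : iIndepFun (fun k => X (k + 1)) P)
    {m : ℕ} (hst : r (m + 1) = r m) (n : ℕ) {f : ℝ → ENNReal} (hf : Measurable f) :
    ∫⁻ ω in {ω | numAccepted r (fun i => X i ω) n = m ∧
        currentThreshold r (fun i => X i ω) n < X (n + 1) ω},
      f (currentThreshold r (fun i => X i ω) (n + 1)) ∂P =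
    ∫⁻ ω in {ω | numAccepted r (fun i => X i ω) n = m ∧
        currentThreshold r (fun i => X i ω) n < X (n + 1) ω},
      (∫⁻ v, f (currentThreshold r (fun i => X i ω) n + v) ∂expMeasure (r m)) ∂P := by
  have hunion : {ω | numAccepted r (fun i => X i ω) n = m ∧
        currentThreshold r (fun i => X i ω) n < X (n + 1) ω} =
      ⋃ Q ∈ (Finset.range n).powerset,
        {ω | (numAccepted r (fun i => X i ω) n = m ∧ above r (fun i => X i ω) n = Q) ∧
        currentThreshold r (fun i => X i ω) n < X (n + 1) ω} := by
    ext ω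
    simp only [Set.mem_ofPred_eq, Set.mem_iUnion, Finset.mem_powerset, exists_prop]
    constructor
    · exact fun h => ⟨_, Finset.filter_subset _ _, ⟨h.1, rfl⟩, h.2⟩
    · rintro ⟨Q, -, h⟩
      exact ⟨h.1.1, h.2⟩
  have hd : Set.PairwiseDisjoint (↑(Finset.range n).powerset) fun Q : Finset ℕ =>
      {ω | (numAccepted r (fun i => X i ω) n = m ∧ above r (fun i => X i ω) n = Q) ∧
        currentThreshold r (fun i => X i ω) n < X (n + 1) ω} := by
    intro Q _ Q' _ hne
    refine Set.disjoint_left.mpr fun ω h h' => hne ?_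
    rw [← h.1.2, ← h'.1.2]
  have hm : ∀ Q ∈ (Finset.range n).powerset, MeasurableSet
      {ω | (numAccepted r (fun i => X i ω) n = m ∧ above r (fun i => X i ω) n = Q) ∧
        currentThreshold r (fun i => X i ω) n < X (n + 1) ω} := fun Q _ =>
    ((measurable_numAccepted hr hX n (measurableSet_singleton m)).inter
      (measurableSet_above_eq hr hX n Q)).inter
      (measurableSet_lt (measurable_currentThreshold hr hX n) (hX n))
  rw [hunion, lintegral_biUnion_finset hd hm, lintegral_biUnion_finset hd hm]
  exact Finset.sum_congr rfl fun Q hQ =>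
    setLIntegral_accept_above hr hX hlaw hind hst (Finset.mem_powerset.mp hQ) hf

/-- If the rank does not change, the threshold increases by an independent exponential variable. -/
theorem map_threshold_succ_of_rank_eq (hr : IsRankSeq r) (hX : ∀ k, Measurable (X (k + 1)))
    (hlaw : ∀ k, P.map (X (k + 1)) = expMeasure 1) (hind : iIndepFun (fun k => X (k + 1)) P)
    {m : ℕ} (hst : r (m + 1) = r m) :
    P.map (fun ω => threshold r (fun i => X i ω) (m + 1)) =
      (P.map fun ω => threshold r (fun i => X i ω) m) ∗ expMeasure (r m) := by
  have hY : ∀ m, Measurable fun ω => threshold r (fun i => X i ω) m :=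
    fun m => measurable_threshold hr hX m
  have := isProbabilityMeasure_expMeasure (r := r m) (by exact_mod_cast hr.one_le m)
  refine Measure.ext_of_lintegral _ fun f hf => ?_
  have hK : Measurable fun y : ℝ => ∫⁻ v, f (y + v) ∂expMeasure (r m) :=
    Measurable.lintegral_prod_right' (f := fun p : ℝ × ℝ => f (p.1 + p.2)) (by fun_prop)
  rw [Measure.lintegral_conv hf, lintegral_map hf (hY _), lintegral_map hK (hY m)]
  -- On `E n` candidate `n + 1` is accepted as number `m + 1`; these events partition the space up
  -- to a null set.
  set E : ℕ → Set Ω := fun n => {ω | numAccepted r (fun i => X i ω) n = m ∧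
        currentThreshold r (fun i => X i ω) n < X (n + 1) ω} with hE
  have hEm : ∀ n, MeasurableSet (E n) := fun n =>
    (measurable_numAccepted hr hX n (measurableSet_singleton m)).inter
      (measurableSet_lt (measurable_currentThreshold hr hX n) (hX n))
  have hlt : ∀ n k ω, ω ∈ E n → ω ∈ E k → ¬ n < k := by
    intro n k ω h h' hnk
    have h1 := numAccepted_succ_of_lt h.2
    have h2 := numAccepted_mono r (fun i => X i ω) (show n + 1 ≤ k from hnk)
    rw [h1, h.1, h'.1] at h2
    omega
  have hd : Pairwise (Function.onFun Disjoint E) := by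
    intro n k hnk
    refine Set.disjoint_left.mpr fun ω h h' => ?_
    rcases hnk.lt_or_gt with h1 | h1
    · exact hlt n k ω h h' h1
    · exact hlt k n ω h' h h1
  have huniv : (⋃ n, E n : Set Ω) =ᵐ[P] Set.univ := by
    filter_upwards [ae_unbounded hX hlaw hind] with ω hω
    obtain ⟨n, hn⟩ := exists_accept (exists_le_numAccepted (r := r) (x := fun i => X i ω) hω (m + 1))
    exact propext ⟨fun _ => trivial, fun _ => Set.mem_iUnion.mpr ⟨n, hn⟩⟩
  have hsplit : ∀ g : Ω → ENNReal, ∫⁻ ω, g ω ∂P = ∑' n, ∫⁻ ω in E n, g ω ∂P := by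
    intro g
    rw [← lintegral_iUnion hEm hd, setLIntegral_congr huniv, setLIntegral_univ]
  rw [hsplit, hsplit]
  refine tsum_congr fun n => Eq.trans ?_
    ((setLIntegral_accept hr hX hlaw hind hst n hf).trans ?_)
  · refine setLIntegral_congr_fun (hEm n) fun ω hω => ?_
    rw [threshold_eq (by rw [numAccepted_succ_of_lt hω.2, hω.1])]
  · refine setLIntegral_congr_fun (hEm n) fun ω hω => ?_
    rw [threshold_eq hω.1]

/-- If the rank increases, the threshold does not change. -/
theorem map_threshold_succ_of_rank_succ (hr : IsRankSeq r) (hX : ∀ k, Measurable (X (k + 1)))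
    (hlaw : ∀ k, P.map (X (k + 1)) = expMeasure 1) (hind : iIndepFun (fun k => X (k + 1)) P)
    {m : ℕ} (hup : r (m + 1) = r m + 1) :
    P.map (fun ω => threshold r (fun i => X i ω) (m + 1)) =
      P.map fun ω => threshold r (fun i => X i ω) m := by
  refine Measure.map_congr ?_
  filter_upwards [ae_unbounded hX hlaw hind, ae_pos hX hlaw] with ω hω hpos
  obtain ⟨n, hn, hlt⟩ := exists_accept (exists_le_numAccepted (r := r) (x := fun i => X i ω) hω (m + 1))
  rw [threshold_eq (by rw [numAccepted_succ_of_lt hlt, hn]), threshold_eq hn,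
    currentThreshold_succ_of_rank_succ hr hpos hlt (by rw [hn, hup])]

theorem threshold_zero (hr : IsRankSeq r) (x : ℕ → ℝ) : threshold r x 0 = 0 := by
  rw [threshold_eq (numAccepted_zero r x)]
  exact thresholdOf_eq_zero (by simp [accepted, hr.1])

end ThresholdLaw

end Hiring

namespace Hiring

/-! ### Moments and characteristic functions of exponential variables and thresholds -/

section ExponentialMoments

open Set

variable {ρ : ℝ}

theorem toReal_exponentialPDF_smul {E : Type*} [NormedAddCommGroup E] [NormedSpace ℝ E]
    (hρ : 0 < ρ) (g : ℝ → E) :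
    (fun x => (exponentialPDF ρ x).toReal • g x) =
      (Ici 0).indicator fun x => (ρ * Real.exp (-(ρ * x))) • g x := by
  ext x
  by_cases hx : 0 ≤ x
  · rw [indicator_of_mem (mem_Ici.mpr hx), exponentialPDF_of_nonneg hx,
      ENNReal.toReal_ofReal (by positivity)]
  · rw [indicator_of_notMem (by simpa using hx), exponentialPDF_of_neg (not_le.mp hx)]
    simp

theorem measurable_exponentialPDF (ρ : ℝ) : Measurable (exponentialPDF ρ) :=
  (measurable_exponentialPDFReal ρ).ennreal_ofReal

theorem integral_expMeasure {E : Type*} [NormedAddCommGroup E] [NormedSpace ℝ E]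
    (hρ : 0 < ρ) (g : ℝ → E) :
    ∫ x, g x ∂expMeasure ρ = ∫ x in Ioi 0, (ρ * Real.exp (-(ρ * x))) • g x := by
  have h := integral_withDensity_eq_integral_toReal_smul (μ := volume)
    (measurable_exponentialPDF ρ) (ae_of_all _ fun _ => ENNReal.ofReal_lt_top) g
  rw [toReal_exponentialPDF_smul hρ, integral_indicator measurableSet_Ici,
    integral_Ici_eq_integral_Ioi] at h
  exact h

theorem integrable_expMeasure_iff {E : Type*} [NormedAddCommGroup E] [NormedSpace ℝ E]
    (hρ : 0 < ρ) (g : ℝ → E) :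
    Integrable g (expMeasure ρ) ↔
      IntegrableOn (fun x => (ρ * Real.exp (-(ρ * x))) • g x) (Ioi 0) := by
  have h := integrable_withDensity_iff_integrable_smul' (μ := volume)
    (measurable_exponentialPDF ρ) (ae_of_all _ fun _ => ENNReal.ofReal_lt_top) (g := g)
  rw [toReal_exponentialPDF_smul hρ, integrable_indicator_iff measurableSet_Ici,
    integrableOn_Ici_iff_integrableOn_Ioi] at h
  exact h

theorem integrable_pow_expMeasure (hρ : 0 < ρ) (k : ℕ) :
    Integrable (fun x => x ^ k) (expMeasure ρ) := by
  rw [integrable_expMeasure_iff hρ]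
  have h := (integrableOn_rpow_mul_exp_neg_mul_rpow (p := 1) (s := k) (b := ρ)
    (by linarith [k.cast_nonneg (α := ℝ)]) one_pos hρ).const_mul ρ
  refine IntegrableOn.congr_fun h (fun x hx => ?_) measurableSet_Ioi
  simp only [Real.rpow_natCast, Real.rpow_one, smul_eq_mul, neg_mul]
  ring

theorem integral_pow_expMeasure (hρ : 0 < ρ) (k : ℕ) :
    ∫ x, x ^ k ∂expMeasure ρ = k.factorial / ρ ^ k := by
  rw [integral_expMeasure hρ]
  have h := Real.integral_rpow_mul_exp_neg_mul_Ioi (a := k + 1) (r := ρ) (by positivity) hρ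
  rw [Real.Gamma_nat_eq_factorial, add_sub_cancel_right] at h
  have h2 : ∫ x in Ioi 0, (ρ * Real.exp (-(ρ * x))) • x ^ k =
      ρ * ∫ x in Ioi 0, x ^ (k : ℝ) * Real.exp (-(ρ * x)) := by
    rw [← integral_const_mul]
    refine setIntegral_congr_fun measurableSet_Ioi fun x _ => ?_
    simp only [Real.rpow_natCast, smul_eq_mul]
    ring
  rw [h2, h, show ((k : ℝ) + 1) = ((k + 1 : ℕ) : ℝ) by push_cast; ring, Real.rpow_natCast, one_div,
    inv_pow, pow_succ]
  field_simp

theorem memLp_id_expMeasure (hρ : 0 < ρ) : MemLp id 2 (expMeasure ρ) :=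
  (memLp_two_iff_integrable_sq measurable_id.aestronglyMeasurable).mpr
    (integrable_pow_expMeasure hρ 2)

theorem integral_id_expMeasure (hρ : 0 < ρ) : ∫ x, x ∂expMeasure ρ = 1 / ρ := by
  simpa using integral_pow_expMeasure hρ 1

theorem variance_id_expMeasure (hρ : 0 < ρ) : Var[id; expMeasure ρ] = 1 / ρ ^ 2 := by
  have := isProbabilityMeasure_expMeasure hρ
  rw [variance_eq_sub (memLp_id_expMeasure hρ)]
  have h := integral_pow_expMeasure hρ 2
  simp only [Pi.pow_apply, id_eq, integral_id_expMeasure hρ, h]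
  norm_num [Nat.factorial]
  ring

theorem charFun_expMeasure (hρ : 0 < ρ) (t : ℝ) :
    charFun (expMeasure ρ) t = (1 - (t / ρ : ℝ) * Complex.I)⁻¹ := by
  have hne : ((ρ : ℂ) - t * Complex.I) ≠ 0 := by
    intro h
    have := congrArg Complex.re h
    simp at this
    exact hρ.ne' this
  have hρ' : (ρ : ℂ) ≠ 0 := by exact_mod_cast hρ.ne'
  rw [charFun_apply_real, integral_expMeasure hρ]
  have h := integral_exp_mul_complex_Ioi (a := -(ρ - t * Complex.I)) (by simpa using hρ) 0
  have h2 : ∫ x : ℝ in Ioi 0, (ρ * Real.exp (-(ρ * x))) • Complex.exp (t * x * Complex.I) =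
      ρ * ∫ x : ℝ in Ioi 0, Complex.exp (-(ρ - t * Complex.I) * x) := by
    rw [← integral_const_mul]
    refine setIntegral_congr_fun measurableSet_Ioi fun x _ => ?_
    simp only [Complex.real_smul]
    push_cast
    rw [mul_assoc, ← Complex.exp_add]
    ring_nf
  rw [h2, h]
  have h3 : 1 - ((t / ρ : ℝ) : ℂ) * Complex.I = (ρ - t * Complex.I) / ρ := by
    push_cast
    field_simp
  rw [h3, Complex.ofReal_zero, mul_zero, Complex.exp_zero, neg_div_neg_eq, inv_div, mul_one_div]

end ExponentialMoments

theorem memLp_id_conv {μ ν : Measure ℝ} [IsProbabilityMeasure μ] [IsProbabilityMeasure ν]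
    (hμ : MemLp id 2 μ) (hν : MemLp id 2 ν) : MemLp id 2 (μ ∗ ν) := by
  rw [Measure.conv, memLp_map_measure_iff (by fun_prop) (by fun_prop)]
  exact (hμ.comp_fst ν).add (hν.comp_snd μ)

theorem integral_id_conv {μ ν : Measure ℝ} [IsProbabilityMeasure μ] [IsProbabilityMeasure ν]
    (hμ : MemLp id 2 μ) (hν : MemLp id 2 ν) :
    ∫ x, x ∂(μ ∗ ν) = ∫ x, x ∂μ + ∫ x, x ∂ν := by
  have h : Integrable (fun x => x) (μ ∗ ν) := (memLp_id_conv hμ hν).integrable one_le_two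
  have hμ' : Integrable (fun x => x) μ := hμ.integrable one_le_two
  have hν' : Integrable (fun x => x) ν := hν.integrable one_le_two
  rw [integral_conv h]
  simp only [integral_add (integrable_const _) hν', integral_const, probReal_univ, one_smul]
  rw [integral_add hμ' (integrable_const _)]
  simp

theorem variance_id_conv {μ ν : Measure ℝ} [IsProbabilityMeasure μ] [IsProbabilityMeasure ν]
    (hμ : MemLp id 2 μ) (hν : MemLp id 2 ν) :
    Var[id; μ ∗ ν] = Var[id; μ] + Var[id; ν] := by
  rw [Measure.conv, variance_id_map (by fun_prop), ← variance_add_prod hμ hν]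
  rfl

/-- The sum of `f (r k)` over those `k < m` at which the rank does not change. -/
noncomputable def staySum {M : Type*} [AddCommMonoid M] (r : ℕ → ℕ) (f : ℝ → M) (m : ℕ) : M :=
  ∑ k ∈ Finset.range m, if r (k + 1) = r k then f (r k) else 0

theorem staySum_succ_of_eq {M : Type*} [AddCommMonoid M] {r : ℕ → ℕ} (f : ℝ → M) {m : ℕ}
    (h : r (m + 1) = r m) : staySum r f (m + 1) = staySum r f m + f (r m) := by
  rw [staySum, Finset.sum_range_succ, if_pos h, staySum]

theorem staySum_succ_of_ne {M : Type*} [AddCommMonoid M] {r : ℕ → ℕ} (f : ℝ → M) {m : ℕ}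
    (h : r (m + 1) ≠ r m) : staySum r f (m + 1) = staySum r f m := by
  rw [staySum, Finset.sum_range_succ, if_neg h, staySum, add_zero]

section Moments

variable {Ω : Type*} [MeasurableSpace Ω] {P : Measure Ω} [IsProbabilityMeasure P] {r : ℕ → ℕ}
  {X : ℕ → Ω → ℝ}

/-- The recursion for the one-dimensional laws suffices: each step without a rank change convolves
with an exponential law, and the others change nothing. No joint law of the thresholds is needed. -/
theorem moments_map_threshold (hr : IsRankSeq r) (hX : ∀ k, Measurable (X (k + 1)))
    (hlaw : ∀ k, P.map (X (k + 1)) = expMeasure 1) (hind : iIndepFun (fun k => X (k + 1)) P)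
    (m : ℕ) :
    MemLp id 2 (P.map fun ω => threshold r (fun i => X i ω) m) ∧
    ∫ y, y ∂(P.map fun ω => threshold r (fun i => X i ω) m) = staySum r (fun a => 1 / a) m ∧
    Var[id; P.map fun ω => threshold r (fun i => X i ω) m] = staySum r (fun a => 1 / a ^ 2) m ∧
    ∀ t, charFun (P.map fun ω => threshold r (fun i => X i ω) m) t =
      ∏ k ∈ Finset.range m, if r (k + 1) = r k then
        (1 - (t / r k : ℝ) * Complex.I)⁻¹ else 1 := by
  induction m with
  | zero =>
    have h0 : (P.map fun ω => threshold r (fun i => X i ω) 0) = Measure.dirac 0 := by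
      simp only [threshold_zero hr, Measure.map_const, measure_univ, one_smul]
    rw [h0]
    refine ⟨?_, ?_, ?_, ?_⟩
    · exact (memLp_const (0 : ℝ)).ae_eq (by simp [Filter.EventuallyEq, ae_dirac_eq])
    · simp [staySum]
    · simp [staySum]
    · intro t
      simp [charFun_dirac]
  | succ m ih =>
    obtain ⟨h1, h2, h3, h4⟩ := ih
    rcases hr.eq_or m with hm | hm
    · have hpos : (0 : ℝ) < r m := by exact_mod_cast hr.one_le m
      have := isProbabilityMeasure_expMeasure hpos
      have := Measure.isProbabilityMeasure_map (μ := P)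
        (measurable_threshold (x := fun ω i => X i ω) hr hX m).aemeasurable
      have he := memLp_id_expMeasure hpos
      rw [map_threshold_succ_of_rank_eq hr hX hlaw hind hm, staySum_succ_of_eq _ hm,
        staySum_succ_of_eq _ hm, integral_id_conv h1 he, variance_id_conv h1 he, h2, h3,
        integral_id_expMeasure hpos, variance_id_expMeasure hpos]
      refine ⟨memLp_id_conv h1 he, rfl, rfl, fun t => ?_⟩
      rw [charFun_conv, h4, Finset.prod_range_succ, if_pos hm, charFun_expMeasure hpos]
    · have hm' : r (m + 1) ≠ r m := by omega
      rw [map_threshold_succ_of_rank_succ hr hX hlaw hind hm, staySum_succ_of_ne _ hm',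
        staySum_succ_of_ne _ hm']
      refine ⟨h1, h2, h3, fun t => ?_⟩
      rw [h4, Finset.prod_range_succ, if_neg hm', mul_one]

theorem memLp_threshold (hr : IsRankSeq r) (hX : ∀ k, Measurable (X (k + 1)))
    (hlaw : ∀ k, P.map (X (k + 1)) = expMeasure 1) (hind : iIndepFun (fun k => X (k + 1)) P)
    (m : ℕ) : MemLp (fun ω => threshold r (fun i => X i ω) m) 2 P :=
  (memLp_map_measure_iff aestronglyMeasurable_id
    (measurable_threshold (x := fun ω i => X i ω) hr hX m).aemeasurable).mp
    (moments_map_threshold hr hX hlaw hind m).1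

theorem integral_threshold (hr : IsRankSeq r) (hX : ∀ k, Measurable (X (k + 1)))
    (hlaw : ∀ k, P.map (X (k + 1)) = expMeasure 1) (hind : iIndepFun (fun k => X (k + 1)) P)
    (m : ℕ) : ∫ ω, threshold r (fun i => X i ω) m ∂P = staySum r (fun a => 1 / a) m := by
  rw [← (moments_map_threshold hr hX hlaw hind m).2.1]
  exact (integral_map (f := fun y => y)
    (measurable_threshold (x := fun ω i => X i ω) hr hX m).aemeasurable
    aestronglyMeasurable_id).symm

theorem variance_threshold (hr : IsRankSeq r) (hX : ∀ k, Measurable (X (k + 1)))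
    (hlaw : ∀ k, P.map (X (k + 1)) = expMeasure 1) (hind : iIndepFun (fun k => X (k + 1)) P)
    (m : ℕ) : Var[fun ω => threshold r (fun i => X i ω) m; P] =
      staySum r (fun a => 1 / a ^ 2) m := by
  rw [← (moments_map_threshold hr hX hlaw hind m).2.2.1, variance_id_map
    (measurable_threshold (x := fun ω i => X i ω) hr hX m).aemeasurable]

end Moments

/-! ### Asymptotics of the variance -/

section Asymptotics

variable {r : ℕ → ℕ}

/-- The omitted terms come from steps at which the rank increases, so their ranks are distinct.
Their sum telescopes through `1 / a ^ 2 ≤ 2 * (1 / a - 1 / (a + 1))`, valid for `a ≥ 1`. -/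
theorem staySum_sq_bounds (hr : IsRankSeq r) (m : ℕ) :
    staySum r (fun a => 1 / a ^ 2) m ≤ ∑ k ∈ Finset.range m, 1 / (r k : ℝ) ^ 2 ∧
    ∑ k ∈ Finset.range m, 1 / (r k : ℝ) ^ 2 ≤
      staySum r (fun a => 1 / a ^ 2) m + 2 * (1 - 1 / (r m : ℝ)) := by
  induction m with
  | zero => simp [staySum, hr.1]
  | succ m ih =>
    have hpos : (1 : ℝ) ≤ r m := by exact_mod_cast hr.one_le m
    rw [Finset.sum_range_succ]
    rcases hr.eq_or m with hm | hm
    · rw [staySum_succ_of_eq _ hm, hm]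
      exact ⟨by linarith [ih.1], by linarith [ih.2]⟩
    · rw [staySum_succ_of_ne _ (by omega), hm]
      have h1 : 0 ≤ 1 / (r m : ℝ) ^ 2 := by positivity
      have h2 : 1 / (r m : ℝ) ^ 2 ≤ 2 * (1 / (r m : ℝ) - 1 / ((r m + 1 : ℕ) : ℝ)) := by
        push_cast
        rw [div_sub_div _ _ (by positivity) (by positivity), mul_div_assoc',
          div_le_div_iff₀ (by positivity) (by positivity)]
        nlinarith
      exact ⟨by linarith [ih.1], by linarith [ih.2]⟩

theorem sigmaHat_sq (r : ℕ → ℕ) (m : ℕ) :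
    sigmaHat r m ^ 2 = ∑ k ∈ Finset.Icc 1 m, 1 / (r k : ℝ) ^ 2 :=
  Real.sq_sqrt (Finset.sum_nonneg fun _ _ => by positivity)

theorem sigmaHat_sq_add_one (hr : IsRankSeq r) (m : ℕ) :
    sigmaHat r m ^ 2 + 1 = ∑ k ∈ Finset.range (m + 1), 1 / (r k : ℝ) ^ 2 := by
  rw [sigmaHat_sq, Finset.sum_range_succ', hr.1]
  simp only [Nat.cast_one, one_pow, div_one, add_left_inj]
  rw [Finset.range_eq_Ico, Finset.sum_Ico_add' (fun k => 1 / (r k : ℝ) ^ 2) 0 m 1]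
  rfl

theorem abs_staySum_sub_sigmaHat_sq_le (hr : IsRankSeq r) (m : ℕ) :
    |staySum r (fun a => 1 / a ^ 2) m - sigmaHat r m ^ 2| ≤ 2 := by
  have h1 := sigmaHat_sq_add_one hr m
  rw [Finset.sum_range_succ] at h1
  obtain ⟨h2, h3⟩ := staySum_sq_bounds hr m
  have hpos : (1 : ℝ) ≤ r m := by exact_mod_cast hr.one_le m
  have h4 : 0 ≤ 1 / (r m : ℝ) ^ 2 := by positivity
  have h5 : 1 / (r m : ℝ) ^ 2 ≤ 1 := by
    rw [div_le_one (by positivity)]; nlinarith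
  have h6 : 0 ≤ 1 / (r m : ℝ) := by positivity
  rw [abs_le]
  constructor <;> linarith

theorem tendsto_sigmaHat (hr : IsRankSeq r) (hsum : ¬ Summable fun m => 1 / (r m : ℝ) ^ 2) :
    Tendsto (sigmaHat r) atTop atTop := by
  have h := (not_summable_iff_tendsto_nat_atTop_of_nonneg fun m => by positivity).mp hsum
  have h1 : Tendsto (fun m => sigmaHat r m ^ 2 + 1) atTop atTop := by
    simp only [sigmaHat_sq_add_one hr]
    exact h.comp (tendsto_add_atTop_nat 1)
  have h2 : Tendsto (fun m => sigmaHat r m ^ 2) atTop atTop :=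
    (tendsto_atTop_add_const_right _ (-1) h1).congr fun m => by ring
  refine (Real.tendsto_sqrt_atTop.comp h2).congr fun m => ?_
  exact Real.sqrt_sq (Real.sqrt_nonneg _)

theorem tendsto_staySum_div_sigmaHat_sq (hr : IsRankSeq r)
    (hsum : ¬ Summable fun m => 1 / (r m : ℝ) ^ 2) :
    Tendsto (fun m => staySum r (fun a => 1 / a ^ 2) m / sigmaHat r m ^ 2) atTop (nhds 1) := by
  have hσ := tendsto_sigmaHat hr hsum
  have h2 : Tendsto (fun m => sigmaHat r m ^ 2) atTop atTop :=
    (tendsto_pow_atTop two_ne_zero).comp hσ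
  have h3 : Tendsto (fun m => (staySum r (fun a => 1 / a ^ 2) m - sigmaHat r m ^ 2) /
      sigmaHat r m ^ 2) atTop (nhds 0) := by
    refine squeeze_zero_norm (fun m => ?_) (h2.const_div_atTop 2)
    rw [norm_div, Real.norm_eq_abs, Real.norm_eq_abs, abs_of_nonneg (sq_nonneg (sigmaHat r m))]
    exact div_le_div_of_nonneg_right (abs_staySum_sub_sigmaHat_sq_le hr m) (sq_nonneg _)
  have h4 := h3.add_const 1
  rw [zero_add] at h4
  refine h4.congr' ?_
  filter_upwards [hσ.eventually_gt_atTop 0] with m hm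
  field_simp
  ring

/-- If `∑ r(m)⁻²` diverges, then `r m ≤ m` from some point on. -/
theorem eventually_rank_le (hr : IsRankSeq r) (hsum : ¬ Summable fun m => 1 / (r m : ℝ) ^ 2) :
    ∀ᶠ m in atTop, r m ≤ m := by
  by_contra hcon
  -- Steps are at most 1, so once `r m ≤ m` holds it persists. Otherwise `r m = m + 1` throughout
  -- and the series converges.
  have hall : ∀ m, r m = m + 1 := by
    intro m
    refine le_antisymm (hr.le_succ m) ?_
    by_contra! h
    refine hcon ((eventually_ge_atTop m).mono fun k hk => ?_)
    have := hr.step_le hk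
    omega
  refine hsum ?_
  have h := (summable_nat_add_iff 1).mpr (Real.summable_one_div_nat_pow.mpr one_lt_two)
  refine h.congr fun m => ?_
  rw [hall m]

end Asymptotics

end Hiring

namespace Hiring

/-! ### Central limit theorem for the thresholds -/

/-- The logarithm of the characteristic function of a centred exponential variable. -/
theorem norm_log_inv_sub_add_sq_le {s : ℝ} (hs : |s| ≤ 1 / 2) :
    ‖Complex.log (1 - s * Complex.I)⁻¹ - s * Complex.I + ((s ^ 2 / 2 : ℝ) : ℂ)‖ ≤ |s| ^ 3 := by
  have hn : ‖(s : ℂ) * Complex.I‖ = |s| := by simp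
  have h := Complex.norm_log_one_sub_inv_add_logTaylor_neg_le 2 (z := s * Complex.I)
    (by rw [hn]; linarith)
  rw [hn] at h
  have e : Complex.logTaylor (2 + 1) (-(s * Complex.I)) =
      - (s * Complex.I) + ((s ^ 2 / 2 : ℝ) : ℂ) := by
    simp only [Complex.logTaylor, Finset.sum_range_succ, Finset.sum_range_zero]
    push_cast
    ring_nf
    simp only [Complex.I_sq]
    ring
  rw [e] at h
  have h2 : (1 - |s|)⁻¹ ≤ 2 := by
    rw [inv_le_comm₀ (by linarith) two_pos]
    linarith
  calc _ ≤ |s| ^ 3 * (1 - |s|)⁻¹ / 3 := by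
        refine le_trans (le_of_eq ?_) (h.trans (le_of_eq (by norm_num)))
        congr 1
        ring
    _ ≤ |s| ^ 3 * 2 / 3 := by gcongr
    _ ≤ |s| ^ 3 := by have : 0 ≤ |s| ^ 3 := by positivity
                      linarith

theorem one_sub_mul_I_ne_zero (s : ℝ) : (1 - s * Complex.I : ℂ) ≠ 0 := by
  intro h
  have := congrArg Complex.re h
  simp at this

variable {Ω : Type*} [MeasurableSpace Ω] {P : Measure Ω} [IsProbabilityMeasure P] {r : ℕ → ℕ}
  {X : ℕ → Ω → ℝ}

/-- Each factor is written as the exponential of its logarithm and the centring is distributed over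
the terms. Only `exp (log z) = z` is used, so the branch of the logarithm is immaterial. -/
theorem charFun_standardized_threshold (hr : IsRankSeq r) (hX : ∀ k, Measurable (X (k + 1)))
    (hlaw : ∀ k, P.map (X (k + 1)) = expMeasure 1) (hind : iIndepFun (fun k => X (k + 1)) P)
    (m : ℕ) (σ t : ℝ) :
    charFun (P.map fun ω => (threshold r (fun i => X i ω) m - staySum r (fun a => 1 / a) m) / σ) t =
      Complex.exp (staySum r (fun a => Complex.log (1 - (t / σ / a : ℝ) * Complex.I)⁻¹
        - (t / σ / a : ℝ) * Complex.I) m) := by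
  have hY : Measurable fun ω => threshold r (fun i => X i ω) m := measurable_threshold hr hX m
  set y : ℝ := staySum r (fun a => 1 / a) m with hy
  have e1 : (fun ω => (threshold r (fun i => X i ω) m - y) / σ) =
      fun ω => σ⁻¹ * (threshold r (fun i => X i ω) m + -y) := by
    ext ω; rw [div_eq_inv_mul, sub_eq_add_neg]
  have e2 : P.map (fun ω => threshold r (fun i => X i ω) m + -y) =
      (P.map fun ω => threshold r (fun i => X i ω) m).map (· + -y) := by
    rw [Measure.map_map (by fun_prop) hY]; rfl
  rw [e1, charFun_map_mul_comp (hY.add_const _).aemeasurable, e2, charFun_map_add_const,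
    (moments_map_threshold hr hX hlaw hind m).2.2.2]
  have h1 : ∀ k, (if r (k + 1) = r k then (1 - ((σ⁻¹ * t / r k : ℝ) : ℂ) * Complex.I)⁻¹ else 1) =
      Complex.exp (if r (k + 1) = r k then
        Complex.log (1 - ((t / σ / r k : ℝ) : ℂ) * Complex.I)⁻¹ else 0) := by
    intro k
    split_ifs
    · rw [Complex.exp_log (inv_ne_zero (one_sub_mul_I_ne_zero _)), div_eq_inv_mul t σ]
    · simp
  rw [Finset.prod_congr rfl fun k _ => h1 k, ← Complex.exp_sum, ← Complex.exp_add]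
  congr 1
  have h2 : ((inner ℝ (-y) (σ⁻¹ * t) : ℝ) : ℂ) * Complex.I =
      -∑ k ∈ Finset.range m, if r (k + 1) = r k then ((t / σ / r k : ℝ) : ℂ) * Complex.I else 0 := by
    have : (inner ℝ (-y) (σ⁻¹ * t) : ℝ) =
        -∑ k ∈ Finset.range m, if r (k + 1) = r k then t / σ / r k else 0 := by
      rw [real_inner_eq_re_inner, RCLike.inner_apply, conj_trivial, RCLike.re_to_real, hy, staySum,
        mul_neg, Finset.mul_sum]
      congr 1
      refine Finset.sum_congr rfl fun k _ => ?_
      split_ifs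
      · ring
      · ring
    rw [this]
    push_cast
    rw [neg_mul, Finset.sum_mul]
    congr 1
    refine Finset.sum_congr rfl fun k _ => ?_
    split_ifs <;> simp
  rw [h2, ← sub_eq_add_neg, ← Finset.sum_sub_distrib, staySum]
  refine Finset.sum_congr rfl fun k _ => ?_
  split_ifs <;> simp

theorem norm_staySum_log_add_le (hr : IsRankSeq r) {t σ : ℝ} (h : |t / σ| ≤ 1 / 2) (m : ℕ) :
    ‖staySum r (fun a => Complex.log (1 - (t / σ / a : ℝ) * Complex.I)⁻¹
        - (t / σ / a : ℝ) * Complex.I) m +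
      (((t / σ) ^ 2 * staySum r (fun a => 1 / a ^ 2) m / 2 : ℝ) : ℂ)‖ ≤
      |t / σ| ^ 3 * staySum r (fun a => 1 / a ^ 2) m := by
  have e : (((t / σ) ^ 2 * staySum r (fun a => 1 / a ^ 2) m / 2 : ℝ) : ℂ) =
      staySum r (fun a => (((t / σ / a) ^ 2 / 2 : ℝ) : ℂ)) m := by
    simp only [staySum, Finset.mul_sum, Finset.sum_div]
    push_cast
    refine Finset.sum_congr rfl fun k _ => ?_
    split_ifs
    · push_cast; ring
    · simp
  rw [e, staySum, staySum, ← Finset.sum_add_distrib, staySum, Finset.mul_sum]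
  refine norm_sum_le_of_le _ fun k _ => ?_
  split_ifs
  · have hpos : (1 : ℝ) ≤ r k := by exact_mod_cast hr.one_le k
    have habs : |t / σ / r k| = |t / σ| / r k := by
      rw [abs_div, abs_of_pos (by linarith : (0 : ℝ) < r k)]
    refine (norm_log_inv_sub_add_sq_le ?_).trans ?_
    · rw [habs]
      exact (div_le_self (abs_nonneg _) hpos).trans h
    -- Since `r k ≥ 1`, the cube of the rank may be replaced by its square; this bounds the total
    -- cubic error by the variance.
    · rw [habs, div_pow, mul_one_div]
      gcongr
      · norm_num
  · simp

/-- The thresholds are asymptotically normal. -/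
theorem tendstoInDistribution_threshold (hr : IsRankSeq r)
    (hsum : ¬ Summable fun m => 1 / (r m : ℝ) ^ 2) (hX : ∀ k, Measurable (X (k + 1)))
    (hlaw : ∀ k, P.map (X (k + 1)) = expMeasure 1) (hind : iIndepFun (fun k => X (k + 1)) P) :
    TendstoInDistribution (fun m ω => (threshold r (fun i => X i ω) m -
      staySum r (fun a => 1 / a) m) / sigmaHat r m) atTop (id : ℝ → ℝ) (fun _ => P)
      (gaussianReal 0 1) where
  forall_aemeasurable m :=
    (((measurable_threshold (x := fun ω i => X i ω) hr hX m).sub_const _).div_const _).aemeasurable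
  aemeasurable_limit := aemeasurable_id
  tendsto := by
    refine ProbabilityMeasure.tendsto_iff_tendsto_charFun.mpr fun t => ?_
    simp only [ProbabilityMeasure.coe_mk, Measure.map_id, charFun_gaussianReal]
    simp only [charFun_standardized_threshold hr hX hlaw hind]
    refine (Complex.continuous_exp.tendsto _).comp ?_
    have hσ := tendsto_sigmaHat hr hsum
    have hv := tendsto_staySum_div_sigmaHat_sq hr hsum
    have h1 : Tendsto (fun m => (t / sigmaHat r m) ^ 2 * staySum r (fun a => 1 / a ^ 2) m / 2)
        atTop (nhds (t ^ 2 / 2)) := by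
      have := (hv.const_mul (t ^ 2)).div_const 2
      rw [mul_one] at this
      refine this.congr fun m => ?_
      rw [div_pow]
      ring
    have hts : Tendsto (fun m => |t / sigmaHat r m|) atTop (nhds 0) := by
      simpa using (hσ.const_div_atTop t).abs
    -- The cubic error is `|t / sigmaHat r m|` times `t ^ 2` times the variance ratio, which tends
    -- to 1.
    have h2 : Tendsto (fun m => |t / sigmaHat r m| ^ 3 * staySum r (fun a => 1 / a ^ 2) m)
        atTop (nhds 0) := by
      have := (hts.mul (hv.const_mul (t ^ 2)))
      rw [zero_mul] at this
      refine this.congr fun m => ?_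
      rw [pow_succ |t / sigmaHat r m| 2, sq_abs, div_pow]
      ring
    have h3 := squeeze_zero_norm' ((hts.eventually_le_const (by norm_num : (0 : ℝ) < 1 / 2)).mono
      fun m hm => norm_staySum_log_add_le hr hm m) h2
    have h4 := h3.sub ((Complex.continuous_ofReal.tendsto _).comp h1)
    refine (h4.congr fun m => ?_).trans (le_of_eq ?_)
    · simp
    · congr 1
      push_cast
      ring_nf

end Hiring

namespace Hiring

/-! ### Concentration of the number of large values -/

/-- The number of values above `s` among the first `n`. -/
noncomputable def countAbove {Ω : Type*} (X : ℕ → Ω → ℝ) (n : ℕ) (s : ℝ) (ω : Ω) : ℕ :=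
  ((Finset.range n).filter (fun k => s < X (k + 1) ω)).card

theorem countAbove_eq_sum {Ω : Type*} (X : ℕ → Ω → ℝ) (n : ℕ) (s : ℝ) (ω : Ω) :
    (countAbove X n s ω : ℝ) =
      ∑ k ∈ Finset.range n, (Set.Ioi s).indicator (fun _ => (1 : ℝ)) (X (k + 1) ω) := by
  simp [countAbove, Set.indicator_apply]

theorem countAbove_mono {Ω : Type*} (X : ℕ → Ω → ℝ) {n n' : ℕ} (h : n ≤ n') (s : ℝ) (ω : Ω) :
    countAbove X n s ω ≤ countAbove X n' s ω :=
  Finset.card_le_card (Finset.filter_subset_filter _ (Finset.range_mono h))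

theorem measurable_indicator_Ioi (s : ℝ) :
    Measurable ((Set.Ioi s).indicator fun _ => (1 : ℝ)) :=
  measurable_const.indicator measurableSet_Ioi

variable {Ω : Type*} [MeasurableSpace Ω] {P : Measure Ω} {r : ℕ → ℕ} {X : ℕ → Ω → ℝ}

theorem memLp_indicator_Ioi [IsProbabilityMeasure P] (hX : ∀ k, Measurable (X (k + 1))) (k : ℕ) (s : ℝ) :
    MemLp (fun ω => (Set.Ioi s).indicator (fun _ => (1 : ℝ)) (X (k + 1) ω)) 2 P := by
  refine MemLp.of_bound ((measurable_indicator_Ioi s).comp (hX k)).aestronglyMeasurable 1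
    (ae_of_all _ fun ω => ?_)
  by_cases h : X (k + 1) ω ∈ Set.Ioi s <;> simp [Set.indicator, h]

theorem integral_indicator_Ioi (hX : ∀ k, Measurable (X (k + 1)))
    (hlaw : ∀ k, P.map (X (k + 1)) = expMeasure 1) (k : ℕ) (s : ℝ) :
    ∫ ω, (Set.Ioi s).indicator (fun _ => (1 : ℝ)) (X (k + 1) ω) ∂P =
      if 0 ≤ s then Real.exp (-s) else 1 := by
  have h : (fun ω => (Set.Ioi s).indicator (fun _ => (1 : ℝ)) (X (k + 1) ω)) =
      {ω | s < X (k + 1) ω}.indicator 1 := by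
    ext ω
    by_cases h : s < X (k + 1) ω <;> simp [h]
  rw [h, integral_indicator_one (measurableSet_lt measurable_const (hX k)), measureReal_def,
    measure_lt_eq hX hlaw, ENNReal.toReal_ofReal]
  split_ifs <;> positivity

variable [IsProbabilityMeasure P]

theorem memLp_countAbove (hX : ∀ k, Measurable (X (k + 1))) (n : ℕ) (s : ℝ) :
    MemLp (fun ω => (countAbove X n s ω : ℝ)) 2 P := by
  simp only [countAbove_eq_sum]
  exact memLp_finsetSum _ fun k _ => memLp_indicator_Ioi hX k s

theorem integral_countAbove (hX : ∀ k, Measurable (X (k + 1)))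
    (hlaw : ∀ k, P.map (X (k + 1)) = expMeasure 1) (n : ℕ) (s : ℝ) :
    ∫ ω, (countAbove X n s ω : ℝ) ∂P = n * if 0 ≤ s then Real.exp (-s) else 1 := by
  simp only [countAbove_eq_sum]
  rw [integral_finsetSum _ fun k _ => (memLp_indicator_Ioi hX k s).integrable one_le_two]
  simp only [integral_indicator_Ioi hX hlaw]
  simp

/-- The count is a sum of independent indicators, and an indicator equals its square, so its
variance is at most its mean. -/
theorem variance_countAbove_le (hX : ∀ k, Measurable (X (k + 1)))
    (hlaw : ∀ k, P.map (X (k + 1)) = expMeasure 1) (hind : iIndepFun (fun k => X (k + 1)) P)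
    (n : ℕ) (s : ℝ) :
    Var[fun ω => (countAbove X n s ω : ℝ); P] ≤ ∫ ω, (countAbove X n s ω : ℝ) ∂P := by
  rw [integral_countAbove hX hlaw]
  have e : (fun ω => (countAbove X n s ω : ℝ)) = ∑ k ∈ Finset.range n,
      fun ω => (Set.Ioi s).indicator (fun _ => (1 : ℝ)) (X (k + 1) ω) := by
    ext ω
    rw [countAbove_eq_sum, Finset.sum_apply]
  rw [e, IndepFun.variance_sum (fun k _ => memLp_indicator_Ioi hX k s)]
  · have h : ∀ k, Var[fun ω => (Set.Ioi s).indicator (fun _ => (1 : ℝ)) (X (k + 1) ω); P] ≤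
        if 0 ≤ s then Real.exp (-s) else 1 := by
      intro k
      refine (variance_le_expectation_sq
        ((measurable_indicator_Ioi s).comp (hX k)).aestronglyMeasurable).trans (le_of_eq ?_)
      rw [← integral_indicator_Ioi hX hlaw k]
      refine integral_congr_ae (ae_of_all _ fun ω => ?_)
      by_cases h : s < X (k + 1) ω <;> simp [h]
    refine (Finset.sum_le_sum fun k _ => h k).trans (le_of_eq ?_)
    simp
  · intro i _ j _ hij
    exact (hind.indepFun hij).comp (measurable_indicator_Ioi s) (measurable_indicator_Ioi s)

/-- Markov's inequality: it is unlikely that there are many large values. -/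
theorem measure_le_countAbove (hX : ∀ k, Measurable (X (k + 1)))
    (hlaw : ∀ k, P.map (X (k + 1)) = expMeasure 1) (n : ℕ) (s : ℝ) {c : ℝ} (hc : 0 < c) :
    P {ω | c ≤ countAbove X n s ω} ≤ ENNReal.ofReal (n * Real.exp (-s) / c) := by
  have h := mul_meas_ge_le_integral_of_nonneg (μ := P)
    (f := fun ω => (countAbove X n s ω : ℝ)) (ae_of_all _ fun ω => Nat.cast_nonneg _)
    ((memLp_countAbove hX n s).integrable one_le_two) c
  rw [integral_countAbove hX hlaw] at h
  rw [← ofReal_measureReal]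
  refine ENNReal.ofReal_le_ofReal ?_
  rw [le_div_iff₀ hc, mul_comm]
  refine h.trans (mul_le_mul_of_nonneg_left ?_ n.cast_nonneg)
  split_ifs with hs
  · exact le_rfl
  · exact Real.one_le_exp (by linarith)

/-- Chebyshev's inequality: it is unlikely that there are few large values. -/
theorem measure_countAbove_lt (hX : ∀ k, Measurable (X (k + 1)))
    (hlaw : ∀ k, P.map (X (k + 1)) = expMeasure 1) (hind : iIndepFun (fun k => X (k + 1)) P)
    (n : ℕ) {s : ℝ} (hs : 0 ≤ s) {c : ℝ} (hc : 0 < c) (hn : 2 * c ≤ n * Real.exp (-s)) :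
    P {ω | countAbove X n s ω < c} ≤ ENNReal.ofReal (4 / (n * Real.exp (-s))) := by
  have hint := integral_countAbove hX hlaw n s
  rw [if_pos hs] at hint
  have hvar := variance_countAbove_le hX hlaw hind n s
  rw [hint] at hvar
  set μ := n * Real.exp (-s) with hμ
  have hμpos : 0 < μ := by linarith
  -- As `c` is at most half the mean, a count below `c` deviates by at least half the mean.
  have h := meas_ge_le_variance_div_sq (memLp_countAbove (P := P) hX n s) (half_pos hμpos)
  rw [hint] at h
  refine (measure_mono fun ω hω => ?_).trans (h.trans (ENNReal.ofReal_le_ofReal ?_))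
  · simp only [Set.mem_ofPred_eq] at hω ⊢
    rw [abs_sub_comm]
    exact le_trans (by linarith) (le_abs_self _)
  · rw [div_le_div_iff₀ (by positivity) hμpos]
    nlinarith

/-! ### Comparison of the acceptance index with the threshold -/

/-- The error when the index of acceptance is estimated by the threshold. -/
noncomputable def logIndexError (r : ℕ → ℕ) (x : ℕ → ℝ) (m : ℕ) : ℝ :=
  Real.log (acceptIndex r x m) - threshold r x m - Real.log (r m)

theorem acceptIndex_pos {x : ℕ → ℝ} {m : ℕ} (hm : 1 ≤ m) (h : ∃ n, m ≤ numAccepted r x n) :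
    0 < acceptIndex r x m := by
  have h1 := numAccepted_acceptIndex h
  by_contra! h2
  rw [Nat.le_zero.mp h2, numAccepted_zero] at h1
  omega

/-- As `Y_m > a`, at least `r m` of the first `N_m` values exceed `a`. But `N_m ≤ r m * exp (a + 1 -
L)`, and among that many candidates the mean number above the deterministic level `a` is only about
`r m * exp (1 - L)`; Markov's inequality applies. -/
theorem measure_threshold_mem_Ioc_and_le (hr : IsRankSeq r) (hX : ∀ k, Measurable (X (k + 1)))
    (hlaw : ∀ k, P.map (X (k + 1)) = expMeasure 1) (hind : iIndepFun (fun k => X (k + 1)) P)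
    {m : ℕ} (hm : 1 ≤ m) (hrm : r m ≤ m) (a L : ℝ) :
    P {ω | threshold r (fun i => X i ω) m ∈ Set.Ioc a (a + 1) ∧
      logIndexError r (fun i => X i ω) m ≤ -L} ≤ ENNReal.ofReal (Real.exp (1 - L)) := by
  have hpos : (0 : ℝ) < r m := by exact_mod_cast hr.one_le m
  set b := r m * Real.exp (a + 1 - L) with hb
  have hb0 : 0 ≤ b := by positivity
  have hsub : {ω | threshold r (fun i => X i ω) m ∈ Set.Ioc a (a + 1) ∧
      logIndexError r (fun i => X i ω) m ≤ -L} ≤ᵐ[P]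
      {ω | (r m : ℝ) ≤ countAbove X ⌊b⌋₊ a ω} := by
    filter_upwards [ae_unbounded hX hlaw hind] with ω hω hmem
    obtain ⟨⟨h1, h2⟩, h3⟩ := hmem
    have hex := exists_le_numAccepted (r := r) (x := fun i => X i ω) hω m
    have hN := numAccepted_acceptIndex hex
    have hNpos : (0 : ℝ) < acceptIndex r (fun i => X i ω) m := by
      exact_mod_cast acceptIndex_pos hm hex
    have hle : (acceptIndex r (fun i => X i ω) m : ℝ) ≤ b := by
      rw [hb, ← Real.exp_log hpos, ← Real.exp_add, ← Real.log_le_iff_le_exp hNpos]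
      rw [logIndexError] at h3
      linarith
    have h4 := le_card_filter_of_lt_currentThreshold hr (x := fun i => X i ω)
      (n := acceptIndex r (fun i => X i ω) m) (s := a) (by rw [hN]; exact hrm) h1
    rw [hN] at h4
    have h5 := h4.trans (countAbove_mono X (Nat.le_floor hle) a ω)
    exact_mod_cast h5
  refine (measure_mono_ae hsub).trans ((measure_le_countAbove hX hlaw _ _ hpos).trans
    (ENNReal.ofReal_le_ofReal ?_))
  rw [div_le_iff₀ hpos]
  calc ⌊b⌋₊ * Real.exp (-a) ≤ b * Real.exp (-a) := by
        gcongr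
        exact Nat.floor_le hb0
    _ = Real.exp (1 - L) * r m := by
        rw [hb, mul_assoc, ← Real.exp_add, mul_comm]
        ring_nf

/-- As `Y_m ≤ a + 1`, fewer than `r m` of the first `N_m` values exceed `a + 1`. But `N_m ≥ r m *
exp (a + L)` makes the mean at least `r m * exp (L - 1) ≥ 2 * r m`; Chebyshev's inequality applies.
-/
theorem measure_threshold_mem_Ioc_and_ge (hr : IsRankSeq r) (hX : ∀ k, Measurable (X (k + 1)))
    (hlaw : ∀ k, P.map (X (k + 1)) = expMeasure 1) (hind : iIndepFun (fun k => X (k + 1)) P)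
    {m : ℕ} (hm : 1 ≤ m) (a : ℝ) {L : ℝ} (hL : 2 ≤ Real.exp (L - 1)) :
    P {ω | threshold r (fun i => X i ω) m ∈ Set.Ioc a (a + 1) ∧
      L ≤ logIndexError r (fun i => X i ω) m} ≤ ENNReal.ofReal (4 * Real.exp (1 - L)) := by
  have hr1 : (1 : ℝ) ≤ r m := by exact_mod_cast hr.one_le m
  have hpos : (0 : ℝ) < r m := by linarith
  -- For a negative level the mean count is not given by `exp`, but the interval then misses the
  -- nonnegative threshold almost surely.
  rcases lt_or_ge (a + 1) 0 with ha | ha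
  · have hnull : {ω | threshold r (fun i => X i ω) m ∈ Set.Ioc a (a + 1) ∧
      L ≤ logIndexError r (fun i => X i ω) m} ≤ᵐ[P] (∅ : Set Ω) := by
      filter_upwards [ae_pos hX hlaw] with ω hω hmem
      have h1 : 0 ≤ threshold r (fun i => X i ω) m := currentThreshold_nonneg hr hω _
      exact absurd (h1.trans hmem.1.2) (not_le.mpr ha)
    refine (measure_mono_ae hnull).trans ?_
    simp
  set b := r m * Real.exp (a + L) with hb
  have hsub : {ω | threshold r (fun i => X i ω) m ∈ Set.Ioc a (a + 1) ∧
      L ≤ logIndexError r (fun i => X i ω) m} ≤ᵐ[P]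
      {ω | countAbove X ⌈b⌉₊ (a + 1) ω < (r m : ℝ)} := by
    filter_upwards [ae_unbounded hX hlaw hind, ae_pos hX hlaw] with ω hω hxpos hmem
    obtain ⟨⟨h1, h2⟩, h3⟩ := hmem
    have hex := exists_le_numAccepted (r := r) (x := fun i => X i ω) hω m
    have hN := numAccepted_acceptIndex hex
    have hNpos : (0 : ℝ) < acceptIndex r (fun i => X i ω) m := by
      exact_mod_cast acceptIndex_pos hm hex
    have hle : b ≤ acceptIndex r (fun i => X i ω) m := by
      rw [hb, ← Real.exp_log hpos, ← Real.exp_add, ← Real.le_log_iff_exp_le hNpos]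
      rw [logIndexError] at h3
      linarith
    have h4 := card_filter_lt_of_currentThreshold_le hr (x := fun i => X i ω) hxpos
      (n := acceptIndex r (fun i => X i ω) m) (s := a + 1) h2
    rw [hN] at h4
    have h5 := (countAbove_mono X (Nat.ceil_le.mpr hle) (a + 1) ω).trans_lt h4
    exact_mod_cast h5
  have hmean : Real.exp (L - 1) * r m ≤ ⌈b⌉₊ * Real.exp (-(a + 1)) := by
    calc Real.exp (L - 1) * r m = b * Real.exp (-(a + 1)) := by
          rw [hb, mul_assoc, ← Real.exp_add, mul_comm]
          ring_nf
      _ ≤ _ := by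
          gcongr
          exact Nat.le_ceil b
  refine (measure_mono_ae hsub).trans ((measure_countAbove_lt hX hlaw hind _ ha hpos ?_).trans
    (ENNReal.ofReal_le_ofReal ?_))
  · exact (mul_le_mul_of_nonneg_right hL hpos.le).trans hmean
  · have h1 : Real.exp (L - 1) ≤ ⌈b⌉₊ * Real.exp (-(a + 1)) :=
      (le_mul_of_one_le_right (Real.exp_pos _).le hr1).trans hmean
    rw [show 1 - L = -(L - 1) by ring, Real.exp_neg (L - 1), ← div_eq_mul_inv]
    exact div_le_div_of_nonneg_left (zero_le_four (α := ℝ)) (Real.exp_pos _) h1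

/-- Chebyshev's inequality keeps `Y_m` within `K` of its mean, and at most `2 * K + 2` unit
intervals cover that window. Each contributes at most `exp (1 - L)` from below and `4 * exp (1 - L)`
from above. -/
theorem measure_le_abs_logIndexError (hr : IsRankSeq r) (hX : ∀ k, Measurable (X (k + 1)))
    (hlaw : ∀ k, P.map (X (k + 1)) = expMeasure 1) (hind : iIndepFun (fun k => X (k + 1)) P)
    {m : ℕ} (hm : 1 ≤ m) (hrm : r m ≤ m) {L : ℝ} (hL : 2 ≤ Real.exp (L - 1)) {K : ℝ}
    (hK : 0 < K) :
    P {ω | L ≤ |logIndexError r (fun i => X i ω) m|} ≤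
      ENNReal.ofReal (staySum r (fun a => 1 / a ^ 2) m / K ^ 2 +
        (2 * K + 2) * (5 * Real.exp (1 - L))) := by
  set y := staySum r (fun a => 1 / a) m with hy
  have hch := meas_ge_le_variance_div_sq (memLp_threshold hr hX hlaw hind m) hK
  rw [integral_threshold hr hX hlaw hind, variance_threshold hr hX hlaw hind, ← hy] at hch
  set J := ⌈2 * K + 1⌉₊ with hJ
  set lo : ℕ → Set Ω := fun j => {ω | threshold r (fun i => X i ω) m ∈
    Set.Ioc (y - K - 1 + j) (y - K - 1 + j + 1) ∧ logIndexError r (fun i => X i ω) m ≤ -L}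
  set hi : ℕ → Set Ω := fun j => {ω | threshold r (fun i => X i ω) m ∈
    Set.Ioc (y - K - 1 + j) (y - K - 1 + j + 1) ∧ L ≤ logIndexError r (fun i => X i ω) m}
  have hcell : ∀ j, P (lo j ∪ hi j) ≤ ENNReal.ofReal (5 * Real.exp (1 - L)) := by
    intro j
    refine (measure_union_le _ _).trans ((add_le_add
      (measure_threshold_mem_Ioc_and_le hr hX hlaw hind hm hrm _ L)
      (measure_threshold_mem_Ioc_and_ge hr hX hlaw hind hm _ hL)).trans (le_of_eq ?_))
    rw [← ENNReal.ofReal_add (by positivity) (by positivity)]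
    congr 1
    ring
  have hsub : {ω | L ≤ |logIndexError r (fun i => X i ω) m|} ⊆
      {ω | K ≤ |threshold r (fun i => X i ω) m - y|} ∪
        ⋃ j ∈ Finset.range J, (lo j ∪ hi j) := by
    intro ω hω
    by_cases hfar : K ≤ |threshold r (fun i => X i ω) m - y|
    · exact Or.inl hfar
    right
    obtain ⟨h1, h2⟩ := abs_lt.mp (not_le.mp hfar)
    -- Starting the intervals at `y - K - 1` gives `1 < u < 2 * K + 1`, so the half-open interval
    -- with index `⌈u⌉₊ - 1` is one of the `J` chosen ones and contains the threshold.
    set u := threshold r (fun i => X i ω) m - (y - K - 1) with hu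
    have hu1 : 1 < u := by linarith
    have hc1 : 1 ≤ ⌈u⌉₊ := Nat.one_le_ceil_iff.mpr (by linarith)
    have hlt : ⌈u⌉₊ ≤ J := Nat.ceil_le_ceil (by linarith)
    have hcast : ((⌈u⌉₊ - 1 : ℕ) : ℝ) = ⌈u⌉₊ - 1 := by push_cast [hc1]; ring
    have hmem : threshold r (fun i => X i ω) m ∈ Set.Ioc (y - K - 1 + ((⌈u⌉₊ - 1 : ℕ) : ℝ))
        (y - K - 1 + ((⌈u⌉₊ - 1 : ℕ) : ℝ) + 1) := by
      rw [hcast]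
      have h3 := Nat.le_ceil u
      have h4 := Nat.ceil_lt_add_one (show 0 ≤ u by linarith)
      constructor <;> linarith
    simp only [Set.mem_iUnion, Finset.mem_range, exists_prop]
    refine ⟨⌈u⌉₊ - 1, by omega, ?_⟩
    have hω' : L ≤ |logIndexError r (fun i => X i ω) m| := hω
    rcases le_abs'.mp hω' with h | h
    · exact Or.inl ⟨hmem, h⟩
    · exact Or.inr ⟨hmem, h⟩
  have hv : 0 ≤ staySum r (fun a => 1 / a ^ 2) m :=
    Finset.sum_nonneg fun k _ => by split_ifs <;> positivity
  have hJle : (J : ℝ) ≤ 2 * K + 2 := by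
    have := (Nat.ceil_lt_add_one (show 0 ≤ 2 * K + 1 by linarith)).le
    linarith
  calc P {ω | L ≤ |logIndexError r (fun i => X i ω) m|}
      ≤ P {ω | K ≤ |threshold r (fun i => X i ω) m - y|} +
        ∑ j ∈ Finset.range J, P (lo j ∪ hi j) :=
        (measure_mono hsub).trans ((measure_union_le _ _).trans
          (add_le_add_right (measure_biUnion_finset_le _ _) _))
    _ ≤ ENNReal.ofReal (staySum r (fun a => 1 / a ^ 2) m / K ^ 2) +
        ∑ j ∈ Finset.range J, ENNReal.ofReal (5 * Real.exp (1 - L)) :=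
        add_le_add hch (Finset.sum_le_sum fun j _ => hcell j)
    _ = ENNReal.ofReal (staySum r (fun a => 1 / a ^ 2) m / K ^ 2 +
        J * (5 * Real.exp (1 - L))) := by
        rw [Finset.sum_const, Finset.card_range, nsmul_eq_mul,
          ENNReal.ofReal_add (by positivity) (by positivity),
          ENNReal.ofReal_mul (Nat.cast_nonneg J), ENNReal.ofReal_natCast]
    _ ≤ _ := by
        refine ENNReal.ofReal_le_ofReal ?_
        gcongr

end Hiring

/-! ### Negligibility of the error and the limit theorem -/

namespace Hiring

variable {Ω : Type*} [MeasurableSpace Ω] {P : Measure Ω} [IsProbabilityMeasure P] {r : ℕ → ℕ}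
  {X : ℕ → Ω → ℝ}

/-- This is the preceding bound with `K = sigmaHat r m ^ 2` and `L = ε * sigmaHat r m`: `K` is far
larger than the standard deviation, yet polynomial in `sigmaHat`, so the exponential beats the
number of intervals. -/
theorem tendsto_logIndexError_bound (hr : IsRankSeq r)
    (hsum : ¬ Summable fun m => 1 / (r m : ℝ) ^ 2) {ε : ℝ} (hε : 0 < ε) :
    Tendsto (fun m => ENNReal.ofReal (staySum r (fun a => 1 / a ^ 2) m / (sigmaHat r m ^ 2) ^ 2 +
      (2 * sigmaHat r m ^ 2 + 2) * (5 * Real.exp (1 - ε * sigmaHat r m)))) atTop (nhds 0) := by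
  have hσ := tendsto_sigmaHat hr hsum
  have h1 : Tendsto (fun m => staySum r (fun a => 1 / a ^ 2) m / (sigmaHat r m ^ 2) ^ 2)
      atTop (nhds 0) := by
    have h := (tendsto_staySum_div_sigmaHat_sq hr hsum).mul
      ((tendsto_pow_atTop two_ne_zero).comp hσ).inv_tendsto_atTop
    rw [mul_zero] at h
    refine h.congr fun m => ?_
    simp only [Pi.inv_apply, Function.comp_apply]
    rw [← div_eq_mul_inv, div_div, ← sq]
  have h2 : Tendsto (fun s : ℝ => (2 * s ^ 2 + 2) * (5 * Real.exp (1 - ε * s))) atTop (nhds 0) := by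
    have hεs : Tendsto (fun s : ℝ => ε * s) atTop atTop := tendsto_id.const_mul_atTop hε
    have ha := ((Real.tendsto_pow_mul_exp_neg_atTop_nhds_zero 2).comp hεs).const_mul
      (10 * Real.exp 1 / ε ^ 2)
    have hb := ((Real.tendsto_pow_mul_exp_neg_atTop_nhds_zero 0).comp hεs).const_mul
      (10 * Real.exp 1)
    have := ha.add hb
    simp only [mul_zero, add_zero] at this
    refine this.congr fun s => ?_
    simp only [Function.comp_apply, pow_zero, one_mul]
    rw [sub_eq_add_neg, Real.exp_add]
    field_simp
    ring
  have h3 := ENNReal.tendsto_ofReal (h1.add (h2.comp hσ))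
  simpa using h3

theorem tendstoInMeasure_logIndexError (hr : IsRankSeq r)
    (hsum : ¬ Summable fun m => 1 / (r m : ℝ) ^ 2) (hX : ∀ k, Measurable (X (k + 1)))
    (hlaw : ∀ k, P.map (X (k + 1)) = expMeasure 1) (hind : iIndepFun (fun k => X (k + 1)) P) :
    TendstoInMeasure P (fun m ω => logIndexError r (fun i => X i ω) m / sigmaHat r m) atTop
      (fun _ => 0) := by
  rw [tendstoInMeasure_iff_norm]
  intro ε hε
  have hσ := tendsto_sigmaHat hr hsum
  refine tendsto_of_tendsto_of_tendsto_of_le_of_le' tendsto_const_nhds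
    (tendsto_logIndexError_bound hr hsum hε) (Eventually.of_forall fun _ => zero_le) ?_
  have hexp : Tendsto (fun m => Real.exp (ε * sigmaHat r m - 1)) atTop atTop :=
    Real.tendsto_exp_atTop.comp
      (tendsto_atTop_add_const_right _ (-1) (hσ.const_mul_atTop hε))
  filter_upwards [eventually_ge_atTop 1, eventually_rank_le hr hsum, hσ.eventually_gt_atTop 0,
    hexp.eventually_ge_atTop 2] with m hm hrm hσm hL
  have h := measure_le_abs_logIndexError hr hX hlaw hind hm hrm hL (pow_pos hσm 2)
  refine (measure_mono fun ω hω => ?_).trans h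
  simp only [Set.mem_ofPred_eq, sub_zero, norm_div, Real.norm_eq_abs, abs_of_pos hσm] at hω ⊢
  exact (le_div_iff₀ hσm).mp hω

theorem tendstoInDistribution_log_acceptIndex (hr : IsRankSeq r)
    (hsum : ¬ Summable fun m => 1 / (r m : ℝ) ^ 2) (hX : ∀ k, Measurable (X (k + 1)))
    (hlaw : ∀ k, P.map (X (k + 1)) = expMeasure 1) (hind : iIndepFun (fun k => X (k + 1)) P) :
    TendstoInDistribution (fun m ω => (Real.log (acceptIndex r (fun i => X i ω) m) -
      (staySum r (fun a => 1 / a) m + Real.log (r m))) / sigmaHat r m) atTop (id : ℝ → ℝ)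
      (fun _ => P) (gaussianReal 0 1) := by
  have hN : ∀ m, Measurable fun ω => Real.log (acceptIndex r (fun i => X i ω) m) := fun m =>
    Real.measurable_log.comp
      ((measurable_of_countable (Nat.cast : ℕ → ℝ)).comp (measurable_acceptIndex hr hX m))
  -- Slutsky's theorem: the standardised `log N_m` is the standardised threshold plus a term tending
  -- to 0 in probability.
  have h := (tendstoInDistribution_threshold hr hsum hX hlaw hind).add_of_tendstoInMeasure_const
    (tendstoInMeasure_logIndexError hr hsum hX hlaw hind) fun m =>
      ((((hN m).sub (measurable_threshold (x := fun ω i => X i ω) hr hX m)).sub_const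
        _).div_const _).aemeasurable
  refine TendstoInDistribution.congr (fun m => ae_of_all _ fun ω => ?_)
    (ae_of_all _ fun x => ?_) h
  · simp only [Pi.add_apply, logIndexError]
    ring
  · simp

end Hiring

theorem mainTheorem5
    {Ω : Type*} [MeasurableSpace Ω] (P : Measure Ω) [IsProbabilityMeasure P]
    (r : ℕ → ℕ) (hr_zero : r 0 = 1)
    (hr_step : ∀ m : ℕ, r m ≤ r (m + 1) ∧ r (m + 1) ≤ r m + 1)
    (hr_small : ¬ Summable (fun m : ℕ => 1 / (r m : ℝ) ^ 2))
    (X : ℕ → Ω → ℝ)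
    (hX_meas : ∀ n : ℕ, 1 ≤ n → Measurable (X n))
    (hX_law : ∀ n : ℕ, 1 ≤ n → P.map (X n) = expMeasure 1)
    (hX_indep : iIndepFun (fun n : ℕ => X (n + 1)) P) :
    (∀ᵐ ω ∂P, ∀ m : ℕ, ∃ n : ℕ, m ≤ Hiring.numAccepted r (fun i => X i ω) n) ∧
    (∀ m : ℕ, Integrable (fun ω => Hiring.threshold r (fun i => X i ω) m) P) ∧
    TendstoInDistribution
      (fun (m : ℕ) (ω : Ω) =>
        (Real.log (Hiring.acceptIndex r (fun i => X i ω) m : ℝ)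
            - ((∫ ω', Hiring.threshold r (fun i => X i ω') m ∂P) + Real.log (r m : ℝ)))
          / Hiring.sigmaHat r m)
      atTop (id : ℝ → ℝ) (fun _ => P) (gaussianReal 0 1) := by
  have hr : Hiring.IsRankSeq r := ⟨hr_zero, hr_step⟩
  have hX : ∀ k, Measurable (X (k + 1)) := fun k => hX_meas _ (Nat.le_add_left 1 k)
  have hlaw : ∀ k, P.map (X (k + 1)) = expMeasure 1 := fun k => hX_law _ (Nat.le_add_left 1 k)
  refine ⟨?_, fun m => ?_, ?_⟩
  · filter_upwards [Hiring.ae_unbounded hX hlaw hX_indep] with ω hω m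
    exact Hiring.exists_le_numAccepted (x := fun i => X i ω) hω m
  · exact (Hiring.memLp_threshold hr hX hlaw hX_indep m).integrable one_le_two
  · simp only [Hiring.integral_threshold hr hX hlaw hX_indep]
    exact Hiring.tendstoInDistribution_log_acceptIndex hr hr_small hX hlaw hX_indep
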